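/- **Notation.** For $r>0$ let $\mathcal A(r)$ be the Fréchet space of functions holomorphic in $|z|<r$ and $C^\infty$ up to the boundary (uniform convergence of all derivatives on $|z|\le r$), and $\mathcal A_0(r)=\{h\in\mathcal A(r):h(0)=0\}$; put $\mathcal A=\mathcal A(1)$, $\mathcal A_0=\mathcal A_0(1)$. Let $\mathbf S_0(r)$ be the set of $F(z)=a_0z+a_1z^2+\cdots\in\mathcal A_0(r)$ that are injective on $|z|\le r$ with $F'\ne 0$ on $|z|\le r$ (smooth univalent functions, bounded by smooth Jordan contours), $\mathbf S(r)=\{f\in\mathbf S_0(r):f'(0)=1\}$, $\mathbf S_0=\mathbf S_0(1)$, $\mathbf S=\mathbf S(1)$. Tangent spaces consist of the velocities of $C^1$ paths. For $F\in\mathbf S_0$ put $$f_1(z)=\tfrac1{a_0}F(z)\in\mathbf S,\qquad f_2(z)=F\!\left(\tfrac z{a_0}\right)\in\mathbf S(|a_0|).$$ Let $\mathrm{Vect}_0S^1$ be the real space of smooth $2\pi$-periodic real functions $\phi(\theta)=\sum_{n\ge1}a_n\cos n\theta+b_n\sin n\theta$ of mean zero, with the complex structure $J\phi=\sum_{n\ge1}-a_n\sin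 n\theta+b_n\cos n\theta$, extended complex linearly to $\mathrm{Vect}_0S^1\otimes\mathbb C$. For $f\in\mathbf S$ the space $T_f\mathcal M^{(1,0)}$ (where $\mathcal M=\mathrm{Diff}\,S^1/S^1$) is the $(1,0)$ space $\mathrm{Vect}^{(1,0)}=\ker(J-i)\subset\mathrm{Vect}_0S^1\otimes\mathbb C$, acting on $f$ by $$\delta_vf(z)=\frac{f(z)^2}{2\pi}\int_{S^1}\Big(\frac{wf'(w)}{f(w)}\Big)^2\frac{v(w)\,dw}{w\,(f(w)-f(z))},\qquad |z|<1.$$ **Theorem.** (0) $\mathbf S_0$ is open in $\mathcal A_0$ and $T_F\mathbf S_0=\mathcal A_0$ for all $F\in\mathbf S_0$. Along every $C^1$ path $F(\cdot,t)$ in $\mathbf S_0$ there is for each $t$ a unique $p=p(\cdot,t)=u_0+u_1z+\cdots\in\mathcal A$ with $\dot F=zF'p$; it satisfies $u_0=\dot a_0/a_0$ and $$\dot f_1=zf_1'\,p(z,t)-\tfrac{\dot a_0}{a_0}f_1\quad\text{(F1)},\qquad \dot f_2=zf_2'\,p\!\left(\tfrac z{a_0},t\right)-\tfrac{\dot a_0}{a_0}zf_2'\quad\text{(F2)},$$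 the first with $\dot f_1$ as a velocity in $\mathcal A_0$, the second pointwise for $|z|<|a_0(t)|$. (1) For $F\in\mathbf S_0$ let $D^1_F$ be the set of right-hand sides $zf_1'p-p(0)f_1$ of (F1), $p\in\mathcal A$. Then $D^1_F=T_{f_1}\mathbf S\subset T_F\mathbf S_0$, and $D^1=(D^1_F)_F$ is a smooth complex sub-bundle of $T\mathbf S_0=\mathbf S_0\times\mathcal A_0$ of complex codimension $1$. (2) The set of right-hand sides $zf_2'p(z/a_0)-p(0)zf_2'$ of (F2), $p\in\mathcal A$, equals $T_{f_2}\mathbf S(|a_0|)$. The map $h(z)\mapsto h(a_0z)$ embeds it into $T_F\mathbf S_0$ and sends that right-hand side to $zF'(p-p(0))$; the images $D^2_F$ form a smooth complex sub-bundle $D^2$ of $T\mathbf S_0$ of complex codimension $1$. Moreover $D^1_F=D^2_F$ as subspaces of $T_F\mathbf S_0$, but the two maps $zF'p\mapsto$ (right-hand side of (F1), resp. (F2)) from $T_F\mathbf S_0$ onto $T_{f_1}\mathbf S$, resp. $T_{f_2}\mathbf S(|a_0|)$, are different: their kernels are the lines $\mathbb CF$ and $\mathbb C\,zF'$, which coincide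 (equivalently, the two right-hand sides vanish for the same $p$) if and only if $F(z)=a_0z$. (3) Functions in $\mathcal A_0$ are determined by their Taylor coefficients, and along a $C^1$ path in $\mathbf S$ the coefficients of the velocity are the derivatives of the coefficients; thus $T_f\mathbf S$ has a natural complex structure, multiplication by $i$ of the coefficient velocities ($\mathbf S\subset\mathbb C^{\mathbb N}$). The map $\phi\mapsto v_\phi=\frac12(\phi\otimes1-J\phi\otimes i)$ is a bijection of $\mathrm{Vect}_0S^1$ onto $\mathrm{Vect}^{(1,0)}$. For every $f=z(1+\sum_{k\ge1}c_kz^k)\in\mathbf S$, $v\mapsto\delta_vf$ (extended to $|z|\le1$) is an injective complex-linear map of $\mathrm{Vect}^{(1,0)}$ onto $T_f\mathbf S$, and it carries $J$ to multiplication of all coefficients by $i$; likewise $\delta_{v_{J\phi}}f=i\,\delta_{v_\phi}f$ coefficientwise. It is given explicitly by (F2): the relation $v=-i\,(p-p(0))|_{S^1}$ assigns to every $p=u_0+u_1z+\cdots\in\mathcal A$ exactly one $v\in\mathrm{Vect}^{(1,0)}$, every $v$ arises in this way, and then $\delta_vf$ is the right-hand side $zf'p-p(0)zf'$ of (F2)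 at $F=f$, with coefficients $$\dot c_n=u_n+\sum_{k=1}^{n-1}(k+1)c_k\,u_{n-k}\quad(n\ge1);$$ if $v=v_\phi$, then $u_n=\frac i2(a_n-ib_n)$ for $n\ge1$, where $a_n,b_n$ are the Fourier coefficients of $\phi$. -/

import Mathlib

open Set Filter Topology Metric
open scoped ContDiff TensorProduct

noncomputable section

/-! ### Functions holomorphic in a disk and smooth up to its boundary -/

/-- The complex vector space of functions on the closed disk `|z| ≤ r` which are `C^∞` in the complex
sense up to the boundary (holomorphic inside, all derivatives extending continuously to the closed
disk).  Such a function is represented by its extension by zero to `ℂ`. -/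
def diskSubmodule (r : ℝ) : Submodule ℂ (ℂ → ℂ) where
  carrier := {f | ContDiffOn ℂ ∞ f (closedBall 0 r) ∧ ∀ z, z ∉ closedBall (0 : ℂ) r → f z = 0}
  add_mem' {f g} hf hg := ⟨hf.1.add hg.1, fun z hz => by simp [hf.2 z hz, hg.2 z hz]⟩
  zero_mem' := ⟨contDiffOn_const, fun _ _ => rfl⟩
  smul_mem' c f hf := ⟨contDiffOn_const.smul hf.1, fun z hz => by simp [hf.2 z hz]⟩

/-- The space of functions on the closed disk `|z| ≤ r`, holomorphic inside and smooth up to the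
boundary (a type of its own, so that it carries the `C^∞` topology and no other one). -/
def DiskFun (r : ℝ) : Type := diskSubmodule r

instance (r : ℝ) : AddCommGroup (DiskFun r) := inferInstanceAs (AddCommGroup (diskSubmodule r))

instance (r : ℝ) : Module ℂ (DiskFun r) := inferInstanceAs (Module ℂ (diskSubmodule r))

instance (r : ℝ) : CoeFun (DiskFun r) (fun _ => ℂ → ℂ) := ⟨fun f => f.1⟩

/-- The `C^∞` (Fréchet) topology: uniform convergence on the closed disk of every derivative. -/
instance (r : ℝ) : TopologicalSpace (DiskFun r) :=
  ⨅ n : ℕ, TopologicalSpace.induced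
    (fun f : DiskFun r => UniformFun.ofFun
      (fun z : closedBall (0 : ℂ) r => iteratedDerivWithin n f (closedBall 0 r) z))
    inferInstance

/-- The functions `a₀ z + a₁ z² + ⋯` : those vanishing at the origin, with the induced topology. -/
def DiskFun₀ (r : ℝ) : Submodule ℂ (DiskFun r) where
  carrier := {f | f 0 = 0}
  add_mem' {f g} hf hg := by
    change f.1 0 + g.1 0 = 0
    rw [show f.1 0 = 0 from hf, show g.1 0 = 0 from hg, add_zero]
  zero_mem' := rfl
  smul_mem' c f hf := by
    change c * f.1 0 = 0
    rw [show f.1 0 = 0 from hf, mul_zero]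

instance (r : ℝ) : CoeFun (DiskFun₀ r) (fun _ => ℂ → ℂ) := ⟨fun f => f.1⟩

theorem DiskFun.contDiffOn {r : ℝ} (f : DiskFun r) : ContDiffOn ℂ ∞ f (closedBall 0 r) := f.2.1

theorem DiskFun.eq_zero {r : ℝ} (f : DiskFun r) {z : ℂ} (hz : z ∉ closedBall (0 : ℂ) r) :
    f z = 0 := f.2.2 z hz

/-- The derivative `f'`, up to the boundary of the disk. -/
def dz {r : ℝ} (f : DiskFun r) (z : ℂ) : ℂ := derivWithin f (closedBall 0 r) z

/-- The `n`-th Taylor coefficient of `f` at the origin. -/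
def coeff {r : ℝ} (f : DiskFun r) (n : ℕ) : ℂ := iteratedDeriv n f 0 / (n.factorial : ℂ)

/-- `a₀ = F'(0)`. -/
def leadCoeff {r : ℝ} (F : DiskFun₀ r) : ℂ := deriv F 0

theorem dz_contDiffOn {r : ℝ} (f : DiskFun r) : ContDiffOn ℂ ∞ (dz f) (closedBall 0 r) := by
  rcases lt_or_ge 0 r with hr | hr
  · have hu : UniqueDiffOn ℂ (closedBall (0 : ℂ) r) :=
      uniqueDiffOn_convex_of_isRCLikeNormedField (convex_closedBall 0 r)
        ⟨0, by rw [interior_closedBall _ hr.ne']; simpa using hr⟩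
    exact f.contDiffOn.derivWithin hu (by simp)
  · intro z hz
    have hs : closedBall (0 : ℂ) r ⊆ {z} := by
      intro w hw
      have hw' : ‖w‖ ≤ 0 := by simpa using (mem_closedBall_zero_iff.1 hw).trans hr
      have hz' : ‖z‖ ≤ 0 := by simpa using (mem_closedBall_zero_iff.1 hz).trans hr
      rw [norm_le_zero_iff.1 hw', norm_le_zero_iff.1 hz']
      rfl
    exact contDiffWithinAt_singleton.mono hs

/-! ### Smooth univalent functions -/

/-- `S₀` on the disk of radius `r`: functions `F(z) = a₀ z + a₁ z² + ⋯`, smooth on the closed disk,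
mapping it diffeomorphically onto its image (so that the boundary is mapped onto a smooth Jordan
contour). -/
def UnivS₀ (r : ℝ) : Set (DiskFun₀ r) :=
  {F | InjOn F (closedBall 0 r) ∧ ∀ z ∈ closedBall (0 : ℂ) r, dz F.1 z ≠ 0}

/-- `S` on the disk of radius `r`: the members of `S₀` normalized by `f'(0) = 1`. -/
def UnivS (r : ℝ) : Set (DiskFun₀ r) := {f | f ∈ UnivS₀ r ∧ leadCoeff f = 1}

/-! ### Paths, tangent vectors, sub-bundles -/

section Tangent

variable {V W : Type} [AddCommGroup V] [Module ℂ V] [TopologicalSpace V]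
  [AddCommGroup W] [Module ℂ W] [TopologicalSpace W]

/-- `γ` is differentiable at `t` with velocity `h`. -/
def HasVelocityAt (γ : ℝ → V) (h : V) (t : ℝ) : Prop :=
  Tendsto (fun s : ℝ => (s - t)⁻¹ • (γ s - γ t)) (𝓝[≠] t) (𝓝 h)

/-- `γ` is a `C¹` path in `X`, defined on `(-ε, ε)`, with velocity `γ'`. -/
def IsC1Path (X : Set V) (ε : ℝ) (γ γ' : ℝ → V) : Prop :=
  (∀ t ∈ Ioo (-ε) ε, γ t ∈ X ∧ HasVelocityAt γ (γ' t) t) ∧ ContinuousOn γ' (Ioo (-ε) ε)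

/-- The tangent space of `X` at `x`: velocities at `x` of the `C¹` paths in `X` through `x`. -/
def tangentSpaceOf (X : Set V) (x : V) : Set V :=
  {h | ∃ ε > 0, ∃ γ γ' : ℝ → V, IsC1Path X ε γ γ' ∧ γ 0 = x ∧ γ' 0 = h}

end Tangent

/-- `g` is `C^n` on the open set `U` (Michal–Bastiani calculus of Fréchet spaces): the directional
derivatives exist and form a map `(x, v) ↦ dg(x, v)` of class `C^(n-1)`. -/
def IsCkOn : (n : ℕ) → {V W : Type} → [AddCommGroup V] → [Module ℂ V] → [TopologicalSpace V] →
    [AddCommGroup W] → [Module ℂ W] → [TopologicalSpace W] → (V → W) → Set V → Prop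
  | 0, _, _, _, _, _, _, _, _, g, U => ContinuousOn g U
  | n + 1, V, W, _, _, _, _, _, _, g, U => ContinuousOn g U ∧ ∃ dg : V × V → W,
      (∀ x ∈ U, ∀ v, Tendsto (fun t : ℝ => t⁻¹ • (g (x + t • v) - g x)) (𝓝[≠] 0) (𝓝 (dg (x, v)))) ∧
        IsCkOn n dg (U ×ˢ univ)

/-- `D` is a smooth complex sub-bundle of (complex) codimension one of the trivial bundle
`X × V → X`, where `X` is an open subset of `V`: the fibres are closed subspaces of codimension one,
and near every `x ∈ X` a smooth family of linear automorphisms of the fibre `V` straightens `D`. -/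
structure IsCodimOneSubbundle {V : Type} [AddCommGroup V] [Module ℂ V] [TopologicalSpace V]
    (X : Set V) (D : V → Submodule ℂ V) : Prop where
  isOpen_base : IsOpen X
  isClosed_fibre : ∀ x ∈ X, IsClosed (D x : Set V)
  codim_fibre : ∀ x ∈ X, Module.finrank ℂ (V ⧸ D x) = 1
  locally_trivial : ∀ x ∈ X, ∃ N : Set V, IsOpen N ∧ x ∈ N ∧ N ⊆ X ∧ ∃ Φ : V → (V ≃ₗ[ℂ] V),
    (∀ y ∈ N, (D x).map (Φ y).toLinearMap = D y) ∧
    (∀ n, IsCkOn n (fun q : V × V => Φ q.1 q.2) (N ×ˢ univ)) ∧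
    (∀ n, IsCkOn n (fun q : V × V => (Φ q.1).symm q.2) (N ×ˢ univ))

/-! ### The alternate Löwner–Kufarev equation and the two factorizations -/

/-- `p ↦ z f'(z) p(z)`, the right-hand side of the (alternate) Löwner–Kufarev equation.  For
`p = u₀ + u₁ z + ⋯` this is `u₀ z f' + u₁ z² f' + ⋯`. -/
def lk {r : ℝ} (f : DiskFun r) : DiskFun r →ₗ[ℂ] DiskFun₀ r where
  toFun p := ⟨⟨fun z => z * dz f z * p z,
    ⟨(contDiffOn_id.mul (dz_contDiffOn f)).mul p.contDiffOn,
      fun z hz => by simp [p.eq_zero hz]⟩⟩, by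
      change (0 : ℂ) * dz f 0 * p 0 = 0
      ring⟩
  map_add' p q := by
    apply Subtype.ext; apply Subtype.ext; funext z
    change z * dz f z * (p.1 z + q.1 z) = z * dz f z * p.1 z + z * dz f z * q.1 z
    ring
  map_smul' c p := by
    apply Subtype.ext; apply Subtype.ext; funext z
    change z * dz f z * (c * p.1 z) = c * (z * dz f z * p.1 z)
    ring

/-- The constant function `1` on the closed disk. -/
def DiskFun.one (r : ℝ) : DiskFun r :=
  ⟨(closedBall (0 : ℂ) r).indicator (fun _ => 1),
    ⟨contDiffOn_const.congr (fun _ hz => indicator_of_mem hz _),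
      fun _ hz => indicator_of_notMem hz _⟩⟩

/-- Evaluation at the origin, `p ↦ u₀ = p(0)`. -/
def evalZero (r : ℝ) : DiskFun r →ₗ[ℂ] ℂ where
  toFun p := p 0
  map_add' _ _ := rfl
  map_smul' _ _ := rfl

/-- Change of variable `f ↦ f(c z)`, from the disk of radius `r` to a disk of radius `s` with
`|c| s ≤ r`. -/
def rescale (c : ℂ) {r s : ℝ} (h : ‖c‖ * s ≤ r) : DiskFun r →ₗ[ℂ] DiskFun s where
  toFun f := ⟨(closedBall (0 : ℂ) s).indicator (fun z => f (c * z)), by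
    refine ⟨ContDiffOn.congr (f := fun z => f (c * z)) ?_ (fun _ hz => indicator_of_mem hz _),
      fun _ hz => indicator_of_notMem hz _⟩
    refine f.contDiffOn.comp (contDiffOn_const.mul contDiffOn_id) ?_
    intro z hz
    rw [mem_closedBall_zero_iff] at hz
    rw [mem_closedBall_zero_iff, norm_mul]
    exact (mul_le_mul_of_nonneg_left hz (norm_nonneg c)).trans h⟩
  map_add' f g := by
    apply Subtype.ext
    exact indicator_add (closedBall (0 : ℂ) s) (fun z => f.1 (c * z)) (fun z => g.1 (c * z))
  map_smul' a f := by
    apply Subtype.ext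
    exact indicator_const_smul (closedBall (0 : ℂ) s) a (fun z => f.1 (c * z))

theorem rescale_mem (c : ℂ) {r s : ℝ} (h : ‖c‖ * s ≤ r) (f : DiskFun r) (hf : f ∈ DiskFun₀ r) :
    rescale c h f ∈ DiskFun₀ s := by
  change (closedBall (0 : ℂ) s).indicator (fun z => f (c * z)) 0 = 0
  have : f (c * 0) = 0 := by rw [mul_zero]; exact hf
  by_cases h0 : (0 : ℂ) ∈ closedBall (0 : ℂ) s
  · rw [indicator_of_mem h0]; exact this
  · exact indicator_of_notMem h0 _

theorem norm_inv_mul_norm_le_one (a : ℂ) : ‖a⁻¹‖ * ‖a‖ ≤ 1 := by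
  rw [norm_inv]
  exact inv_mul_le_one

/-- First factorization: `f₁(z) = F(z) / a₀`. -/
def factor₁ (F : DiskFun₀ 1) : DiskFun₀ 1 := (leadCoeff F)⁻¹ • F

/-- Second factorization: `f₂(z) = F(z / a₀)`, a function on the disk `|z| ≤ |a₀|`. -/
def factor₂ (F : DiskFun₀ 1) : DiskFun₀ ‖leadCoeff F‖ :=
  ⟨rescale (leadCoeff F)⁻¹ (norm_inv_mul_norm_le_one _) F.1, rescale_mem _ _ _ F.2⟩

/-- Right-hand side of (F1) as a function of `p`: `z f₁' p - u₀ f₁`, with `u₀ = p(0)`. -/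
def rhsF1 (F : DiskFun₀ 1) : DiskFun 1 →ₗ[ℂ] DiskFun₀ 1 :=
  lk (factor₁ F).1 - (evalZero 1).smulRight (factor₁ F)

/-- Right-hand side of (F2) as a function of `p`: `z f₂' p(z / a₀) - u₀ z f₂'`, with `u₀ = p(0)`. -/
def rhsF2 (F : DiskFun₀ 1) : DiskFun 1 →ₗ[ℂ] DiskFun₀ ‖leadCoeff F‖ :=
  lk (factor₂ F).1 ∘ₗ rescale (leadCoeff F)⁻¹ (norm_inv_mul_norm_le_one _) -
    (evalZero 1).smulRight (lk (factor₂ F).1 (DiskFun.one _))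

/-- The embedding of the functions on `|z| ≤ |a₀|` into those on the unit disk which belongs to the
second factorization `F(z) = f₂(a₀ z)`: it sends `h` to `h(a₀ z)`. -/
def embed₂ (F : DiskFun₀ 1) : DiskFun₀ ‖leadCoeff F‖ →ₗ[ℂ] DiskFun₀ 1 :=
  (rescale (leadCoeff F) (mul_one ‖leadCoeff F‖).le).restrict
    (fun f hf => rescale_mem _ (mul_one ‖leadCoeff F‖).le f hf)

/-- The first distribution: at `F` all the velocities given by (F1). -/
def dist₁ (F : DiskFun₀ 1) : Submodule ℂ (DiskFun₀ 1) := LinearMap.range (rhsF1 F)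

/-- The second distribution: at `F` all the velocities given by (F2), embedded by `h ↦ h(a₀ z)`. -/
def dist₂ (F : DiskFun₀ 1) : Submodule ℂ (DiskFun₀ 1) := (LinearMap.range (rhsF2 F)).map (embed₂ F)

/-! ### Vector fields on the circle and the complex structure `J` -/

/-- `Vect₀ S¹`: smooth real `2π`-periodic functions `φ(θ)` with vanishing mean value. -/
def Vect₀ : Submodule ℝ (ℝ → ℝ) where
  carrier := {φ | ContDiff ℝ ∞ φ ∧ Function.Periodic φ (2 * Real.pi) ∧
    ∫ θ in (0 : ℝ)..2 * Real.pi, φ θ = 0}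
  add_mem' {φ ψ} hφ hψ := ⟨hφ.1.add hψ.1, hφ.2.1.add hψ.2.1, by
    change ∫ θ in (0 : ℝ)..2 * Real.pi, (φ θ + ψ θ) = 0
    rw [intervalIntegral.integral_add (hφ.1.continuous.intervalIntegrable _ _)
      (hψ.1.continuous.intervalIntegrable _ _), hφ.2.2, hψ.2.2, add_zero]⟩
  zero_mem' := ⟨contDiff_const, fun _ => rfl, by simp⟩
  smul_mem' c φ hφ := ⟨contDiff_const.smul hφ.1, hφ.2.1.smul c, by
    change ∫ θ in (0 : ℝ)..2 * Real.pi, c * φ θ = 0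
    rw [intervalIntegral.integral_const_mul, hφ.2.2, mul_zero]⟩

/-- The Fourier coefficient `a_n` of `φ(θ) = ∑ a_n cos nθ + b_n sin nθ`. -/
def fourierCos (φ : ℝ → ℝ) (n : ℕ) : ℝ :=
  Real.pi⁻¹ * ∫ θ in (0 : ℝ)..2 * Real.pi, φ θ * Real.cos (n * θ)

/-- The Fourier coefficient `b_n` of `φ(θ) = ∑ a_n cos nθ + b_n sin nθ`. -/
def fourierSin (φ : ℝ → ℝ) (n : ℕ) : ℝ :=
  Real.pi⁻¹ * ∫ θ in (0 : ℝ)..2 * Real.pi, φ θ * Real.sin (n * θ)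

/-- The term of order `n` of the series of `J(φ)`. -/
def conjTerm (φ : ℝ → ℝ) (n : ℕ) (θ : ℝ) : ℝ :=
  -fourierCos φ n * Real.sin (n * θ) + fourierSin φ n * Real.cos (n * θ)

/-- The function `J(φ)(θ) = ∑_{n ≥ 1} -a_n sin nθ + b_n cos nθ`. -/
def conjSeries (φ : ℝ → ℝ) (θ : ℝ) : ℝ := ∑' n : ℕ, conjTerm φ (n + 1) θ

section ConjAux

variable {φ ψ : ℝ → ℝ}

theorem fourierCos_deriv (hφ : ContDiff ℝ ∞ φ) (hp : Function.Periodic φ (2 * Real.pi)) (n : ℕ) :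
    fourierCos (deriv φ) n = n * fourierSin φ n := by
  have hd : ∀ x, HasDerivAt φ (deriv φ x) x := fun x =>
    (hφ.differentiable (by simp) x).hasDerivAt
  have hc : Continuous (deriv φ) := hφ.continuous_deriv (by simp)
  have hv : ∀ x : ℝ, HasDerivAt (fun θ : ℝ => Real.cos (n * θ)) (-Real.sin (n * x) * n) x := by
    intro x
    simpa using ((hasDerivAt_id x).const_mul (n : ℝ)).cos
  have h := intervalIntegral.integral_deriv_mul_eq_sub (a := 0) (b := 2 * Real.pi) (u := φ)
    (v := fun θ : ℝ => Real.cos (n * θ)) (u' := deriv φ)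
    (v' := fun x => -Real.sin (n * x) * n) (fun x _ => hd x) (fun x _ => hv x)
    (hc.intervalIntegrable _ _) (Continuous.intervalIntegrable (by fun_prop) _ _)
  have e0 : φ (2 * Real.pi) = φ 0 := by simpa using hp 0
  have e1 : Real.cos (n * (2 * Real.pi)) = 1 := Real.cos_nat_mul_two_pi n
  rw [e0, e1, mul_zero, Real.cos_zero, sub_self, intervalIntegral.integral_add
    (Continuous.intervalIntegrable (by fun_prop) _ _)
    (Continuous.intervalIntegrable (by have := hφ.continuous; fun_prop) _ _)] at h
  have e2 : ∫ x in (0 : ℝ)..2 * Real.pi, φ x * (-Real.sin (n * x) * n) =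
      -(n * ∫ x in (0 : ℝ)..2 * Real.pi, φ x * Real.sin (n * x)) := by
    rw [← intervalIntegral.integral_const_mul, ← intervalIntegral.integral_neg]
    congr 1; ext x; ring
  rw [e2] at h
  unfold fourierCos fourierSin
  linear_combination Real.pi⁻¹ * h

theorem fourierSin_deriv (hφ : ContDiff ℝ ∞ φ) (n : ℕ) :
    fourierSin (deriv φ) n = -(n * fourierCos φ n) := by
  have hd : ∀ x, HasDerivAt φ (deriv φ x) x := fun x =>
    (hφ.differentiable (by simp) x).hasDerivAt
  have hc : Continuous (deriv φ) := hφ.continuous_deriv (by simp)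
  have hv : ∀ x : ℝ, HasDerivAt (fun θ : ℝ => Real.sin (n * θ)) (Real.cos (n * x) * n) x := by
    intro x
    simpa using ((hasDerivAt_id x).const_mul (n : ℝ)).sin
  have h := intervalIntegral.integral_deriv_mul_eq_sub (a := 0) (b := 2 * Real.pi) (u := φ)
    (v := fun θ : ℝ => Real.sin (n * θ)) (u' := deriv φ)
    (v' := fun x => Real.cos (n * x) * n) (fun x _ => hd x) (fun x _ => hv x)
    (hc.intervalIntegrable _ _) (Continuous.intervalIntegrable (by fun_prop) _ _)
  have e1 : Real.sin (n * (2 * Real.pi)) = 0 := by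
    rw [show (n : ℝ) * (2 * Real.pi) = ((2 * n : ℕ) : ℝ) * Real.pi by push_cast; ring]
    exact Real.sin_nat_mul_pi _
  rw [e1, mul_zero, mul_zero, Real.sin_zero, mul_zero, sub_self, intervalIntegral.integral_add
    (Continuous.intervalIntegrable (by fun_prop) _ _)
    (Continuous.intervalIntegrable (by have := hφ.continuous; fun_prop) _ _)] at h
  have e2 : ∫ x in (0 : ℝ)..2 * Real.pi, φ x * (Real.cos (n * x) * n) =
      n * ∫ x in (0 : ℝ)..2 * Real.pi, φ x * Real.cos (n * x) := by
    rw [← intervalIntegral.integral_const_mul]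
    congr 1; ext x; ring
  rw [e2] at h
  unfold fourierCos fourierSin
  linear_combination Real.pi⁻¹ * h

theorem contDiff_deriv_of_contDiff (hφ : ContDiff ℝ ∞ φ) : ContDiff ℝ ∞ (deriv φ) :=
  (contDiff_infty_iff_deriv.1 hφ).2

theorem periodic_deriv (hp : Function.Periodic φ (2 * Real.pi)) :
    Function.Periodic (deriv φ) (2 * Real.pi) := by
  intro x
  rw [← deriv_comp_add_const, show (fun x => φ (x + 2 * Real.pi)) = φ from funext hp]

theorem exists_fourier_bound (hφ : Continuous φ) :
    ∃ C, ∀ n, |fourierCos φ n| ≤ C ∧ |fourierSin φ n| ≤ C := by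
  obtain ⟨M, hM⟩ := isCompact_Icc.exists_bound_of_continuousOn
    (s := Icc (0 : ℝ) (2 * Real.pi)) hφ.continuousOn
  refine ⟨Real.pi⁻¹ * (M * |2 * Real.pi - 0|), fun n => ?_⟩
  have hpi : |Real.pi⁻¹| = Real.pi⁻¹ := abs_of_pos (inv_pos.2 Real.pi_pos)
  have key : ∀ g : ℝ → ℝ, (∀ x, |g x| ≤ 1) →
      |∫ θ in (0 : ℝ)..2 * Real.pi, φ θ * g θ| ≤ M * |2 * Real.pi - 0| := by
    intro g hg
    rw [← Real.norm_eq_abs]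
    refine intervalIntegral.norm_integral_le_of_norm_le_const fun x hx => ?_
    rw [uIoc_of_le (by positivity)] at hx
    have h1 := hM x ⟨hx.1.le, hx.2⟩
    rw [norm_mul]
    calc ‖φ x‖ * ‖g x‖ ≤ ‖φ x‖ * 1 := mul_le_mul_of_nonneg_left (hg x) (norm_nonneg _)
      _ ≤ M := by rw [mul_one]; exact h1
  constructor
  · unfold fourierCos
    rw [abs_mul, hpi]
    exact mul_le_mul_of_nonneg_left (key _ fun x => Real.abs_cos_le_one _)
      (inv_pos.2 Real.pi_pos).le
  · unfold fourierSin
    rw [abs_mul, hpi]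
    exact mul_le_mul_of_nonneg_left (key _ fun x => Real.abs_sin_le_one _)
      (inv_pos.2 Real.pi_pos).le

theorem exists_fourier_decay (hφ : ContDiff ℝ ∞ φ) (hp : Function.Periodic φ (2 * Real.pi)) :
    ∃ C, ∀ n : ℕ, |fourierCos φ (n + 1)| ≤ C * (1 / ((n + 1 : ℕ) : ℝ) ^ 2) ∧
      |fourierSin φ (n + 1)| ≤ C * (1 / ((n + 1 : ℕ) : ℝ) ^ 2) := by
  have h1 := contDiff_deriv_of_contDiff hφ
  have p1 := periodic_deriv hp
  obtain ⟨C, hC⟩ := exists_fourier_bound (contDiff_deriv_of_contDiff h1).continuous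
  refine ⟨C, fun n => ?_⟩
  have hn : (0 : ℝ) < ((n + 1 : ℕ) : ℝ) := by positivity
  have hn2 := pow_pos hn 2
  obtain ⟨hc, hs⟩ := hC (n + 1)
  rw [fourierCos_deriv h1 p1, fourierSin_deriv hφ] at hc
  rw [fourierSin_deriv h1, fourierCos_deriv hφ hp] at hs
  constructor
  · rw [mul_one_div, le_div_iff₀ hn2]
    calc _ = |((n + 1 : ℕ) : ℝ) * -(((n + 1 : ℕ) : ℝ) * fourierCos φ (n + 1))| := by
          rw [abs_mul, abs_neg, abs_mul, abs_of_pos hn]; ring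
      _ ≤ C := hc
  · rw [mul_one_div, le_div_iff₀ hn2]
    calc _ = |-(((n + 1 : ℕ) : ℝ) * (((n + 1 : ℕ) : ℝ) * fourierSin φ (n + 1)))| := by
          rw [abs_neg, abs_mul, abs_mul, abs_of_pos hn]; ring
      _ ≤ C := hs

theorem conjTerm_bound (hφ : ContDiff ℝ ∞ φ) (hp : Function.Periodic φ (2 * Real.pi)) :
    ∃ u : ℕ → ℝ, Summable u ∧ ∀ n θ, ‖conjTerm φ (n + 1) θ‖ ≤ u n := by
  obtain ⟨C, hC⟩ := exists_fourier_decay hφ hp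
  refine ⟨fun n => 2 * (C * (1 / ((n + 1 : ℕ) : ℝ) ^ 2)), ?_, fun n θ => ?_⟩
  · exact (((summable_nat_add_iff 1).2
      (Real.summable_one_div_nat_pow.2 one_lt_two)).mul_left C).mul_left 2
  · obtain ⟨hc, hs⟩ := hC n
    unfold conjTerm
    refine (norm_add_le _ _).trans ?_
    rw [norm_mul, norm_mul, norm_neg, Real.norm_eq_abs, Real.norm_eq_abs, Real.norm_eq_abs,
      Real.norm_eq_abs]
    have t1 := mul_le_of_le_one_right (abs_nonneg (fourierCos φ (n + 1)))
      (Real.abs_sin_le_one (((n + 1 : ℕ) : ℝ) * θ))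
    have t2 := mul_le_of_le_one_right (abs_nonneg (fourierSin φ (n + 1)))
      (Real.abs_cos_le_one (((n + 1 : ℕ) : ℝ) * θ))
    linarith

theorem conjTerm_summable (hφ : ContDiff ℝ ∞ φ) (hp : Function.Periodic φ (2 * Real.pi)) (θ : ℝ) :
    Summable fun n : ℕ => conjTerm φ (n + 1) θ := by
  obtain ⟨u, hu, h⟩ := conjTerm_bound hφ hp
  exact Summable.of_norm_bounded hu fun n => h n θ

theorem conjTerm_hasDerivAt (hφ : ContDiff ℝ ∞ φ) (hp : Function.Periodic φ (2 * Real.pi))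
    (n : ℕ) (θ : ℝ) : HasDerivAt (conjTerm φ n) (conjTerm (deriv φ) n θ) θ := by
  have hid := (hasDerivAt_id θ).const_mul (n : ℝ)
  have h := (hid.sin.const_mul (-fourierCos φ n)).add (hid.cos.const_mul (fourierSin φ n))
  refine h.congr_deriv ?_
  unfold conjTerm
  rw [fourierCos_deriv hφ hp, fourierSin_deriv hφ]
  simp only [id]
  ring

theorem conjSeries_hasDerivAt (hφ : ContDiff ℝ ∞ φ) (hp : Function.Periodic φ (2 * Real.pi))
    (θ : ℝ) : HasDerivAt (conjSeries φ) (conjSeries (deriv φ) θ) θ := by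
  obtain ⟨u, hu, h⟩ := conjTerm_bound (contDiff_deriv_of_contDiff hφ) (periodic_deriv hp)
  exact hasDerivAt_tsum hu (fun n y => conjTerm_hasDerivAt hφ hp (n + 1) y) h
    (conjTerm_summable hφ hp 0) θ

theorem conjSeries_contDiff (hφ : ContDiff ℝ ∞ φ) (hp : Function.Periodic φ (2 * Real.pi)) :
    ContDiff ℝ ∞ (conjSeries φ) := by
  rw [contDiff_infty]
  intro k
  induction k generalizing φ with
  | zero =>
    exact contDiff_zero.2 (continuous_iff_continuousAt.2 fun θ =>
      (conjSeries_hasDerivAt hφ hp θ).continuousAt)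
  | succ k ih =>
    rw [show ((k + 1 : ℕ) : WithTop ℕ∞) = (k : WithTop ℕ∞) + 1 by push_cast; rfl,
      contDiff_succ_iff_deriv]
    refine ⟨fun θ => (conjSeries_hasDerivAt hφ hp θ).differentiableAt, by simp, ?_⟩
    rw [show deriv (conjSeries φ) = conjSeries (deriv φ) from
      funext fun θ => (conjSeries_hasDerivAt hφ hp θ).deriv]
    exact ih (contDiff_deriv_of_contDiff hφ) (periodic_deriv hp)

theorem conjSeries_periodic (φ : ℝ → ℝ) : Function.Periodic (conjSeries φ) (2 * Real.pi) := by
  intro θ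
  refine tsum_congr fun n => ?_
  unfold conjTerm
  rw [mul_add, Real.sin_add_nat_mul_two_pi, Real.cos_add_nat_mul_two_pi]

theorem conjTerm_integral (φ : ℝ → ℝ) (n : ℕ) :
    ∫ θ in (0 : ℝ)..2 * Real.pi, conjTerm φ (n + 1) θ = 0 := by
  have hn : ((n + 1 : ℕ) : ℝ) ≠ 0 := by positivity
  have h := intervalIntegral.integral_eq_sub_of_hasDerivAt (a := 0) (b := 2 * Real.pi)
    (f := fun θ => ((n + 1 : ℕ) : ℝ)⁻¹ * (fourierCos φ (n + 1) * Real.cos ((n + 1 : ℕ) * θ) +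
      fourierSin φ (n + 1) * Real.sin ((n + 1 : ℕ) * θ)))
    (f' := conjTerm φ (n + 1)) (fun θ _ => by
      have hid := (hasDerivAt_id θ).const_mul ((n + 1 : ℕ) : ℝ)
      have h := ((hid.cos.const_mul (fourierCos φ (n + 1))).add
        (hid.sin.const_mul (fourierSin φ (n + 1)))).const_mul ((n + 1 : ℕ) : ℝ)⁻¹
      refine h.congr_deriv ?_
      unfold conjTerm
      simp only [id]
      field_simp) (Continuous.intervalIntegrable (by unfold conjTerm; fun_prop) _ _)
  rw [h, show Real.cos (((n + 1 : ℕ) : ℝ) * (2 * Real.pi)) = 1 from Real.cos_nat_mul_two_pi _,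
    show Real.sin (((n + 1 : ℕ) : ℝ) * (2 * Real.pi)) = 0 by
      rw [show ((n + 1 : ℕ) : ℝ) * (2 * Real.pi) = ((2 * (n + 1) : ℕ) : ℝ) * Real.pi by
        push_cast; ring]
      exact Real.sin_nat_mul_pi _]
  simp

theorem conjSeries_integral (hφ : ContDiff ℝ ∞ φ) (hp : Function.Periodic φ (2 * Real.pi)) :
    ∫ θ in (0 : ℝ)..2 * Real.pi, conjSeries φ θ = 0 := by
  obtain ⟨u, hu, h⟩ := conjTerm_bound hφ hp
  have hs := intervalIntegral.hasSum_integral_of_dominated_convergence (a := 0)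
    (b := 2 * Real.pi) (μ := MeasureTheory.volume) (F := fun n θ => conjTerm φ (n + 1) θ)
    (f := conjSeries φ) (fun n _ => u n)
    (fun n => Continuous.aestronglyMeasurable (by unfold conjTerm; fun_prop))
    (fun n => Eventually.of_forall fun θ _ => h n θ)
    (Eventually.of_forall fun θ _ => hu) (by simp [intervalIntegrable_const])
    (Eventually.of_forall fun θ _ => (conjTerm_summable hφ hp θ).hasSum)
  refine hs.unique ?_
  simp only [conjTerm_integral]
  exact hasSum_zero

theorem conjTerm_add (hφ : ContDiff ℝ ∞ φ) (hψ : ContDiff ℝ ∞ ψ) (n : ℕ) (θ : ℝ) :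
    conjTerm (φ + ψ) n θ = conjTerm φ n θ + conjTerm ψ n θ := by
  have hc := hφ.continuous
  have hd := hψ.continuous
  unfold conjTerm fourierCos fourierSin
  simp only [Pi.add_apply, add_mul]
  rw [intervalIntegral.integral_add (Continuous.intervalIntegrable (by fun_prop) _ _)
    (Continuous.intervalIntegrable (by fun_prop) _ _),
    intervalIntegral.integral_add (Continuous.intervalIntegrable (by fun_prop) _ _)
    (Continuous.intervalIntegrable (by fun_prop) _ _)]
  ring

theorem conjTerm_smul (c : ℝ) (φ : ℝ → ℝ) (n : ℕ) (θ : ℝ) :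
    conjTerm (c • φ) n θ = c * conjTerm φ n θ := by
  unfold conjTerm fourierCos fourierSin
  simp only [Pi.smul_apply, smul_eq_mul, mul_assoc, intervalIntegral.integral_const_mul]
  ring

end ConjAux

/-- The almost complex structure `J` on `Vect₀ S¹`: it sends `∑ a_n cos nθ + b_n sin nθ` to
`∑ -a_n sin nθ + b_n cos nθ`. -/
def complexStructureJ : Vect₀ →ₗ[ℝ] Vect₀ where
  toFun φ := ⟨conjSeries φ.1, conjSeries_contDiff φ.2.1 φ.2.2.1, conjSeries_periodic φ.1,
    conjSeries_integral φ.2.1 φ.2.2.1⟩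
  map_add' φ ψ := by
    apply Subtype.ext; funext θ
    change ∑' n : ℕ, conjTerm (φ.1 + ψ.1) (n + 1) θ = conjSeries φ.1 θ + conjSeries ψ.1 θ
    simp only [conjTerm_add φ.2.1 ψ.2.1]
    exact (conjTerm_summable φ.2.1 φ.2.2.1 θ).tsum_add (conjTerm_summable ψ.2.1 ψ.2.2.1 θ)
  map_smul' c φ := by
    apply Subtype.ext; funext θ
    change ∑' n : ℕ, conjTerm (c • φ.1) (n + 1) θ = c * conjSeries φ.1 θ
    simp only [conjTerm_smul]
    exact tsum_mul_left

/-- The complexification `Vect₀ S¹ ⊗ ℂ`. -/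
abbrev Vect₀C : Type := ℂ ⊗[ℝ] Vect₀

/-- The complex-linear extension of `J` to the complexification. -/
def complexStructureJC : Vect₀C →ₗ[ℂ] Vect₀C := complexStructureJ.baseChange ℂ

/-- The `(1,0)` space: the eigenspace of `J` on `Vect₀ S¹ ⊗ ℂ` for the eigenvalue `i`. -/
def Vect₀10 : Submodule ℂ Vect₀C := Module.End.eigenspace complexStructureJC Complex.I

/-- An element of `Vect₀ S¹ ⊗ ℂ` as a complex-valued function of `θ`: `z ⊗ φ ↦ z φ(θ)`. -/
def toBoundaryFun : Vect₀C →ₗ[ℂ] (ℝ → ℂ) :=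
  LinearMap.liftBaseChange ℂ
    { toFun := fun φ θ => ((φ.1 θ : ℝ) : ℂ)
      map_add' := fun φ ψ => by funext θ; exact Complex.ofReal_add _ _
      map_smul' := fun c φ => by
        funext θ
        change ((c * φ.1 θ : ℝ) : ℂ) = c • ((φ.1 θ : ℝ) : ℂ)
        rw [Complex.ofReal_mul, Complex.real_smul] }

/-- The Schaeffer–Spencer variation
`δ_v f(z) = f(z)² / (2π) ∫_{S¹} (w f'(w) / f(w))² v(w) dw / (w (f(w) - f(z)))`, with `w = e^{iθ}`
and `v(w) = g(θ)`. -/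
def variation (f : DiskFun₀ 1) (g : ℝ → ℂ) (z : ℂ) : ℂ :=
  f z ^ 2 / (2 * Real.pi) * ∫ θ in (0 : ℝ)..2 * Real.pi,
    (circleMap 0 1 θ * dz f.1 (circleMap 0 1 θ) / f (circleMap 0 1 θ)) ^ 2 * g θ /
      (circleMap 0 1 θ * (f (circleMap 0 1 θ) - f z)) * deriv (circleMap 0 1) θ

end

/-! ### The Fréchet topology -/

section FrechetTopology

variable {r : ℝ}

/-! Parts (0)–(2) rest on one division. If `F'` has no zero on the closed disk, then `p ↦ z F' p` is
a bijection onto the functions vanishing at `0`, because `h / z` is smooth up to the boundary when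
`h(0) = 0` (`lk_injective`, `lk_surjective`). Under this bijection `h'(0) = a₀ p(0)`
(`leadCoeff_lk`). The set `S₀` is open, since univalence with nonvanishing derivative survives a
`C¹`-small perturbation (`isOpen_UnivS₀`). Straight segments therefore realize all tangent vectors,
and the tangent spaces of `S` are given by `h'(0) = 0`. Both right-hand sides range over exactly
this hyperplane (`range_rhsF1`, `range_rhsF2`). So the two distributions are the same constant
sub-bundle, and only the kernels differ: one is cut out by `z F' p = p(0) F`, the other by `p =
p(0)`.

For part (3), let `q(0) = 0` and `v = -i q` on the circle. In the variational integrand all zeros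
cancel except that of `w - z`, and Cauchy's formula gives `δ_v f = z f' q` (`variation_eq_lk`). It
remains to identify the `(1,0)` vectors with the boundary values of holomorphic functions vanishing
at `0`. The series `∑ (a_n - i b_n) z^n` is smooth up to the boundary by rapid decay, and its
boundary values are `φ - i Jφ` (`holomorphicPart_circleMap`). Conversely, such a function is
determined by the real part of its boundary values. On `(1,0)` vectors `J` is multiplication by `i`,
so complex linearity gives the statement about coefficients. -/

theorem uniqueDiffOn_closedDisk (hr : 0 < r) : UniqueDiffOn ℂ (closedBall (0 : ℂ) r) :=
  uniqueDiffOn_convex_of_isRCLikeNormedField (convex_closedBall 0 r)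
    ⟨0, by rw [interior_closedBall _ hr.ne']; simpa using hr⟩

theorem zero_mem_closedDisk [hr : Fact (0 < r)] : (0 : ℂ) ∈ closedBall (0 : ℂ) r :=
  mem_closedBall_self hr.out.le

theorem DiskFun.ext_of_eqOn {f g : DiskFun r} (h : ∀ z ∈ closedBall (0 : ℂ) r, f z = g z) :
    f = g := by
  apply Subtype.ext
  funext z
  by_cases hz : z ∈ closedBall (0 : ℂ) r
  · exact h z hz
  · exact (f.eq_zero hz).trans (g.eq_zero hz).symm

theorem DiskFun₀.ext_of_eqOn {f g : DiskFun₀ r} (h : ∀ z ∈ closedBall (0 : ℂ) r, f z = g z) :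
    f = g :=
  Subtype.ext (DiskFun.ext_of_eqOn h)

/-- The `n`-th derivative as a continuous function on the closed disk. -/
noncomputable def DiskFun.jet (r : ℝ) [hr : Fact (0 < r)] (n : ℕ) :
    DiskFun r →ₗ[ℂ] C(closedBall (0 : ℂ) r, ℂ) where
  toFun f := ⟨fun z => iteratedDerivWithin n f (closedBall 0 r) z,
    (f.contDiffOn.continuousOn_iteratedDerivWithin (by exact_mod_cast le_top)
      (uniqueDiffOn_closedDisk hr.out)).domRestrict⟩
  map_add' f g := by
    ext z
    exact iteratedDerivWithin_add z.2 (uniqueDiffOn_closedDisk hr.out)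
      ((f.contDiffOn.of_le (by exact_mod_cast le_top)) z z.2)
      ((g.contDiffOn.of_le (by exact_mod_cast le_top)) z z.2)
  map_smul' c f := by
    ext z
    exact iteratedDerivWithin_const_smul z.2 (uniqueDiffOn_closedDisk hr.out) c
      ((f.contDiffOn.of_le (by exact_mod_cast le_top)) z z.2)

/-- On the compact disk, uniform convergence of continuous functions is convergence in the sup norm.
In this form the topology is induced by linear maps into normed spaces, hence compatible with the
vector space structure. -/
theorem DiskFun.topology_eq (r : ℝ) [hr : Fact (0 < r)] :
    instTopologicalSpaceDiskFun r =
      ⨅ n, TopologicalSpace.induced (DiskFun.jet r n) inferInstance := by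
  change (⨅ n : ℕ, _) = _
  refine iInf_congr fun n => ?_
  have : CompactSpace (closedBall (0 : ℂ) r) :=
    isCompact_iff_compactSpace.1 (isCompact_closedBall 0 r)
  have h := (ContinuousMap.isUniformEmbedding_uniformFunOfFun
    (α := closedBall (0 : ℂ) r) (β := ℂ)).isInducing.eq_induced
  have h' := congrArg (TopologicalSpace.induced (DiskFun.jet r n)) h
  rw [induced_compose] at h'
  exact h'.symm

instance DiskFun.isTopologicalAddGroup [Fact (0 < r)] : IsTopologicalAddGroup (DiskFun r) := by
  have := topologicalAddGroup_iInf (G := DiskFun r)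
    (ts' := fun n => TopologicalSpace.induced (DiskFun.jet r n) inferInstance)
    fun n => topologicalAddGroup_induced (DiskFun.jet r n)
  rwa [← DiskFun.topology_eq r] at this

instance DiskFun.continuousSMul [Fact (0 < r)] : ContinuousSMul ℂ (DiskFun r) := by
  have := continuousSMul_iInf (X := DiskFun r) (M := ℂ)
    (ts' := fun n => TopologicalSpace.induced (DiskFun.jet r n) inferInstance)
    fun n => continuousSMul_induced (DiskFun.jet r n)
  rwa [← DiskFun.topology_eq r] at this

theorem DiskFun.continuous_jet (r : ℝ) [Fact (0 < r)] (n : ℕ) :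
    Continuous (DiskFun.jet r n) := by
  rw [continuous_iff_le_induced, DiskFun.topology_eq r]
  exact iInf_le _ n

/-- The value of the `n`-th derivative at a point of the closed disk is a continuous functional. -/
theorem DiskFun.continuous_iteratedDerivWithin [Fact (0 < r)] (n : ℕ) {z : ℂ}
    (hz : z ∈ closedBall (0 : ℂ) r) :
    Continuous fun f : DiskFun r => iteratedDerivWithin n f (closedBall 0 r) z := by
  have h := continuous_eval_const (F := C(closedBall (0 : ℂ) r, ℂ)) (⟨z, hz⟩ : closedBall (0 : ℂ) r)
  exact h.comp (DiskFun.continuous_jet r n)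

instance DiskFun.continuousSMul_real [Fact (0 < r)] : ContinuousSMul ℝ (DiskFun r) :=
  ⟨(continuous_smul (M := ℂ) (X := DiskFun r)).comp
    (f := fun q : ℝ × DiskFun r => ((q.1 : ℂ), q.2)) (by fun_prop)⟩

instance DiskFun₀.continuousSMul_real [Fact (0 < r)] : ContinuousSMul ℝ (DiskFun₀ r) :=
  ⟨(continuous_smul (M := ℂ) (X := DiskFun₀ r)).comp
    (f := fun q : ℝ × DiskFun₀ r => ((q.1 : ℂ), q.2)) (by fun_prop)⟩

/-! ### Derivatives inside the disk -/

theorem closedDisk_mem_nhds {z : ℂ} (hz : z ∈ ball (0 : ℂ) r) : closedBall (0 : ℂ) r ∈ 𝓝 z :=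
  mem_of_superset (isOpen_ball.mem_nhds hz) ball_subset_closedBall

theorem DiskFun.hasDerivWithinAt (f : DiskFun r) {z : ℂ} (hz : z ∈ closedBall (0 : ℂ) r) :
    HasDerivWithinAt f (dz f z) (closedBall 0 r) z :=
  ((f.contDiffOn.differentiableOn (by simp)) z hz).hasDerivWithinAt

theorem DiskFun.hasDerivAt (f : DiskFun r) {z : ℂ} (hz : z ∈ ball (0 : ℂ) r) :
    HasDerivAt f (dz f z) z :=
  (f.hasDerivWithinAt (ball_subset_closedBall hz)).hasDerivAt (closedDisk_mem_nhds hz)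

theorem DiskFun.continuousOn (f : DiskFun r) : ContinuousOn f (closedBall 0 r) :=
  f.contDiffOn.continuousOn

theorem DiskFun.differentiableOn_ball (f : DiskFun r) : DifferentiableOn ℂ f (ball 0 r) :=
  fun _ hz => (f.hasDerivAt hz).differentiableAt.differentiableWithinAt

theorem leadCoeff_eq_dz [hr : Fact (0 < r)] (F : DiskFun₀ r) : leadCoeff F = dz F.1 0 :=
  (F.1.hasDerivAt (mem_ball_self hr.out)).deriv

theorem coeff_eq_iteratedDerivWithin [hr : Fact (0 < r)] (f : DiskFun r) (n : ℕ) :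
    coeff f n = iteratedDerivWithin n f (closedBall 0 r) 0 / n.factorial := by
  rw [coeff, iteratedDerivWithin_eq_iteratedDeriv (uniqueDiffOn_closedDisk hr.out)
    ((f.contDiffOn.contDiffAt (closedDisk_mem_nhds (mem_ball_self hr.out))).of_le
      (by exact_mod_cast le_top)) zero_mem_closedDisk]

theorem continuous_leadCoeff [hr : Fact (0 < r)] : Continuous (leadCoeff (r := r)) := by
  simp_rw [funext fun F : DiskFun₀ r => leadCoeff_eq_dz F, dz, ← iteratedDerivWithin_one]
  exact (DiskFun.continuous_iteratedDerivWithin 1 zero_mem_closedDisk).comp continuous_subtype_val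

/-- The `n`-th Taylor coefficient as a linear functional. -/
noncomputable def coeffLinear (r : ℝ) [hr : Fact (0 < r)] (n : ℕ) : DiskFun r →ₗ[ℂ] ℂ where
  toFun f := coeff f n
  map_add' f g := by
    simp only [coeff_eq_iteratedDerivWithin, ← add_div]
    congr 1
    exact iteratedDerivWithin_add zero_mem_closedDisk (uniqueDiffOn_closedDisk hr.out)
      ((f.contDiffOn.of_le (by exact_mod_cast le_top)) _ zero_mem_closedDisk)
      ((g.contDiffOn.of_le (by exact_mod_cast le_top)) _ zero_mem_closedDisk)
  map_smul' c f := by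
    simp only [coeff_eq_iteratedDerivWithin, RingHom.id_apply, smul_eq_mul, ← mul_div_assoc]
    congr 1
    exact iteratedDerivWithin_const_smul zero_mem_closedDisk (uniqueDiffOn_closedDisk hr.out) c
      ((f.contDiffOn.of_le (by exact_mod_cast le_top)) _ zero_mem_closedDisk)

theorem continuous_coeffLinear (r : ℝ) [hr : Fact (0 < r)] (n : ℕ) :
    Continuous (coeffLinear r n) := by
  change Continuous fun f : DiskFun r => coeff f n
  simp_rw [coeff_eq_iteratedDerivWithin]
  exact (DiskFun.continuous_iteratedDerivWithin n zero_mem_closedDisk).div_const _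

/-- `F ↦ F'(0)` as a linear functional. -/
noncomputable def leadCoeffLinear (r : ℝ) [hr : Fact (0 < r)] : DiskFun₀ r →ₗ[ℂ] ℂ :=
  coeffLinear r 1 ∘ₗ (DiskFun₀ r).subtype

@[simp]
theorem leadCoeffLinear_apply [hr : Fact (0 < r)] (F : DiskFun₀ r) :
    leadCoeffLinear r F = leadCoeff F := by
  change coeff F.1 1 = _
  simp [coeff, leadCoeff]

theorem leadCoeff_smul [hr : Fact (0 < r)] (c : ℂ) (F : DiskFun₀ r) :
    leadCoeff (c • F) = c * leadCoeff F := by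
  simp only [← leadCoeffLinear_apply, map_smul, smul_eq_mul]

theorem leadCoeff_add [hr : Fact (0 < r)] (F G : DiskFun₀ r) :
    leadCoeff (F + G) = leadCoeff F + leadCoeff G := by
  simp only [← leadCoeffLinear_apply, map_add]

end FrechetTopology

/-! ### Openness of the set of smooth univalent functions -/

section Univalent

variable {r : ℝ} [hr : Fact (0 < r)]

/-- Compactness of the set of pairs reduces the bound to a local one. Near the diagonal it comes
from `F' ≠ 0`, away from it from injectivity. -/
theorem UnivS₀.exists_expansion_bound {F : DiskFun₀ r} (hF : F ∈ UnivS₀ r) :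
    ∃ c > 0, ∀ z ∈ closedBall (0 : ℂ) r, ∀ w ∈ closedBall (0 : ℂ) r,
      c * ‖z - w‖ ≤ ‖F z - F w‖ := by
  have hcont := F.1.continuousOn
  suffices h : ∃ c > 0, ∀ q ∈ closedBall (0 : ℂ) r ×ˢ closedBall (0 : ℂ) r,
      c * ‖q.1 - q.2‖ ≤ ‖F q.1 - F q.2‖ by
    obtain ⟨c, hc, h⟩ := h
    exact ⟨c, hc, fun z hz w hw => h (z, w) ⟨hz, hw⟩⟩
  refine ((isCompact_closedBall (0 : ℂ) r).prod (isCompact_closedBall (0 : ℂ) r)).induction_on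
    (p := fun s => ∃ c > 0, ∀ q ∈ s, c * ‖q.1 - q.2‖ ≤ ‖F q.1 - F q.2‖) ?_ ?_ ?_ ?_
  · exact ⟨1, one_pos, by simp⟩
  · rintro s t hst ⟨c, hc, h⟩
    exact ⟨c, hc, fun q hq => h q (hst hq)⟩
  · rintro s t ⟨c, hc, h⟩ ⟨d, hd, h'⟩
    refine ⟨min c d, lt_min hc hd, ?_⟩
    rintro q (hq | hq)
    · exact (mul_le_mul_of_nonneg_right (min_le_left _ _) (norm_nonneg _)).trans (h q hq)
    · exact (mul_le_mul_of_nonneg_right (min_le_right _ _) (norm_nonneg _)).trans (h' q hq)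
  · rintro ⟨z₀, w₀⟩ ⟨hz₀, hw₀⟩
    by_cases hne : z₀ = w₀
    · subst hne
      have ha : 0 < ‖dz F.1 z₀‖ := norm_pos_iff.2 (hF.2 z₀ hz₀)
      have hd := (dz_contDiffOn F.1).continuousOn z₀ hz₀
      obtain ⟨δ, hδ, hball⟩ := Metric.mem_nhdsWithin_iff.1
        (hd (Metric.ball_mem_nhds _ (half_pos ha)))
      refine ⟨(ball z₀ δ ∩ closedBall 0 r) ×ˢ (ball z₀ δ ∩ closedBall 0 r), ?_,
        ‖dz F.1 z₀‖ / 2, half_pos ha, ?_⟩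
      · rw [nhdsWithin_prod_eq]
        exact prod_mem_prod (inter_mem_nhdsWithin' hδ) (inter_mem_nhdsWithin' hδ)
      · rintro ⟨z, w⟩ ⟨hz, hw⟩
        have hconv : Convex ℝ (ball z₀ δ ∩ closedBall (0 : ℂ) r) :=
          (convex_ball _ _).inter (convex_closedBall _ _)
        -- After subtraction of the linear part at `z₀` the derivative is at most `|F'(z₀)| / 2` on
        -- this convex piece, so the linear part dominates.
        have key := hconv.norm_image_sub_le_of_norm_hasDerivWithin_le
          (f := fun x => F x - dz F.1 z₀ * x) (f' := fun x => dz F.1 x - dz F.1 z₀)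
          (C := ‖dz F.1 z₀‖ / 2) (fun x hx => by
            have h1 := (F.1.hasDerivWithinAt hx.2).mono
              (inter_subset_right : ball z₀ δ ∩ closedBall (0 : ℂ) r ⊆ _)
            have h2 := h1.sub ((hasDerivWithinAt_id x _).const_mul (dz F.1 z₀))
            rw [mul_one] at h2
            exact h2)
          (fun x hx => by
            have := hball hx
            rw [mem_preimage, mem_ball_iff_norm] at this
            exact this.le) hw hz
        have e : F z - dz F.1 z₀ * z - (F w - dz F.1 z₀ * w) =
          (F z - F w) - dz F.1 z₀ * (z - w) := by ring
        simp only [e] at key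
        have h2 := norm_sub_norm_le (dz F.1 z₀ * (z - w)) (F z - F w)
        rw [norm_sub_rev (dz F.1 z₀ * (z - w)), norm_mul] at h2
        simp only
        linarith
    · have hd : 0 < ‖F z₀ - F w₀‖ :=
        norm_pos_iff.2 (sub_ne_zero.2 fun h => hne (hF.1 hz₀ hw₀ h))
      have hc : ContinuousWithinAt (fun q : ℂ × ℂ => ‖F q.1 - F q.2‖)
          (closedBall 0 r ×ˢ closedBall 0 r) (z₀, w₀) := by
        have hK : ContinuousOn (fun q : ℂ × ℂ => ‖F q.1 - F q.2‖)
            (closedBall 0 r ×ˢ closedBall 0 r) :=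
          ((hcont.comp continuousOn_fst fun q hq => hq.1).sub
            (hcont.comp continuousOn_snd fun q hq => hq.2)).norm
        exact hK _ ⟨hz₀, hw₀⟩
      have hev := hc.eventually (lt_mem_nhds (half_lt_self hd))
      -- By continuity the images stay at least half as far apart as those of `z₀` and `w₀`, while
      -- `|z - w| ≤ 2r`.
      refine ⟨_, inter_mem hev self_mem_nhdsWithin, ‖F z₀ - F w₀‖ / 2 / (2 * r),
        div_pos (half_pos hd) (mul_pos two_pos hr.out), ?_⟩
      rintro ⟨z, w⟩ ⟨h1, hz, hw⟩
      simp only [mem_ofPred_eq] at h1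
      refine le_trans ?_ h1.le
      rw [mem_closedBall_zero_iff] at hz hw
      have h3 : ‖z - w‖ ≤ 2 * r := (norm_sub_le _ _).trans (by linarith)
      rw [div_mul_eq_mul_div, div_le_iff₀ (mul_pos two_pos hr.out)]
      exact mul_le_mul_of_nonneg_left h3 (half_pos hd).le
where
  inter_mem_nhdsWithin' {z₀ : ℂ} {δ : ℝ} (hδ : 0 < δ) :
      ball z₀ δ ∩ closedBall 0 r ∈ 𝓝[closedBall (0 : ℂ) r] z₀ :=
    inter_mem (mem_nhdsWithin_of_mem_nhds (ball_mem_nhds _ hδ)) self_mem_nhdsWithin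

theorem UnivS₀.exists_le_norm_dz {F : DiskFun₀ r} (hF : F ∈ UnivS₀ r) :
    ∃ c > 0, ∀ z ∈ closedBall (0 : ℂ) r, c ≤ ‖dz F.1 z‖ := by
  obtain ⟨z₀, hz₀, hmin⟩ := (isCompact_closedBall (0 : ℂ) r).exists_isMinOn
    ⟨0, zero_mem_closedDisk⟩ (dz_contDiffOn F.1).continuousOn.norm
  exact ⟨_, norm_pos_iff.2 (hF.2 z₀ hz₀), fun z hz => hmin hz⟩

/-- Only first derivatives matter. If `|G' - F'|` stays below the expansion constant of `F`, then `G
- F` moves points too little to undo the expansion; if it stays below `min |F'|`, then `G'` has no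
zero. -/
theorem isOpen_UnivS₀ : IsOpen (UnivS₀ r) := by
  rw [isOpen_iff_mem_nhds]
  intro F hF
  obtain ⟨c, hc, hexp⟩ := UnivS₀.exists_expansion_bound hF
  obtain ⟨d, hd, hdz⟩ := UnivS₀.exists_le_norm_dz hF
  have : CompactSpace (closedBall (0 : ℂ) r) :=
    isCompact_iff_compactSpace.1 (isCompact_closedBall 0 r)
  have hcont : Continuous fun G : DiskFun₀ r => DiskFun.jet r 1 G.1 :=
    (DiskFun.continuous_jet r 1).comp continuous_subtype_val
  filter_upwards [hcont.continuousAt (Metric.ball_mem_nhds (DiskFun.jet r 1 F.1) (lt_min hc hd))]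
    with G hG
  have hG' : ∀ z ∈ closedBall (0 : ℂ) r, ‖dz G.1 z - dz F.1 z‖ < min c d := by
    intro z hz
    have h1 := (ContinuousMap.dist_apply_le_dist (f := DiskFun.jet r 1 G.1)
      (g := DiskFun.jet r 1 F.1) ⟨z, hz⟩).trans_lt hG
    rw [dist_eq_norm] at h1
    have e : ∀ H : DiskFun r, DiskFun.jet r 1 H ⟨z, hz⟩ = dz H z := fun H =>
      congrFun iteratedDerivWithin_one z
    rwa [e, e] at h1
  refine ⟨fun z hz w hw hzw => ?_, fun z hz h0 => ?_⟩
  · by_contra hne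
    have hlt : 0 < ‖z - w‖ := norm_pos_iff.2 (sub_ne_zero.2 hne)
    -- The maximum of `|G' - F'|` is attained, so it is a Lipschitz constant of `G - F` strictly
    -- smaller than `c`.
    obtain ⟨x₀, hx₀, hmax⟩ := (isCompact_closedBall (0 : ℂ) r).exists_isMaxOn
      ⟨0, zero_mem_closedDisk⟩
      ((dz_contDiffOn G.1).continuousOn.sub (dz_contDiffOn F.1).continuousOn).norm
    have key := (convex_closedBall (0 : ℂ) r).norm_image_sub_le_of_norm_hasDerivWithin_le
      (f := fun x => G x - F x) (fun x hx =>
        (G.1.hasDerivWithinAt hx).sub (F.1.hasDerivWithinAt hx)) (fun x hx => hmax hx) hw hz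
    have e : G z - F z - (G w - F w) = -(F z - F w) := by rw [hzw]; ring
    simp only [e, norm_neg] at key
    have h2 := hexp z hz w hw
    have h3 : ‖dz G.1 x₀ - dz F.1 x₀‖ < c := (hG' x₀ hx₀).trans_le (min_le_left _ _)
    have := mul_lt_mul_of_pos_right h3 hlt
    simp only [Pi.sub_apply] at key
    linarith
  · have h1 := (hG' z hz).trans_le (min_le_right _ _)
    rw [h0, zero_sub, norm_neg] at h1
    exact absurd (hdz z hz) (not_le.2 h1)

theorem leadCoeff_ne_zero {F : DiskFun₀ r} (hF : F ∈ UnivS₀ r) : leadCoeff F ≠ 0 := by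
  rw [leadCoeff_eq_dz]
  exact hF.2 0 zero_mem_closedDisk

end Univalent

/-! ### Velocities and tangent spaces -/

section Velocity

variable {V W : Type} [AddCommGroup V] [Module ℂ V] [TopologicalSpace V]
  [AddCommGroup W] [Module ℂ W] [TopologicalSpace W]

/-- Linear maps commute with difference quotients. Applied to coefficient functionals, this turns
Fréchet velocities into ordinary derivatives. -/
theorem HasVelocityAt.map {γ : ℝ → V} {h : V} {t : ℝ} (hγ : HasVelocityAt γ h t)
    (L : V →ₗ[ℂ] W) (hL : Continuous L) : HasVelocityAt (fun s => L (γ s)) (L h) t := by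
  have := (hL.tendsto h).comp hγ
  refine this.congr fun s => ?_
  simp only [Function.comp_apply, ← Complex.coe_smul, map_smul, map_sub]

theorem hasVelocityAt_iff_hasDerivAt {γ : ℝ → ℂ} {h : ℂ} {t : ℝ} :
    HasVelocityAt γ h t ↔ HasDerivAt γ h t :=
  hasDerivAt_iff_tendsto_slope.symm

theorem HasVelocityAt.smul [IsTopologicalAddGroup V] [ContinuousSMul ℂ V] {b : ℝ → ℂ} {b' : ℂ}
    {γ : ℝ → V} {h : V} {t : ℝ} (hb : HasDerivAt b b' t) (hγ : HasVelocityAt γ h t) :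
    HasVelocityAt (fun s => b s • γ s) (b t • h + b' • γ t) t := by
  have h1 : Tendsto b (𝓝[≠] t) (𝓝 (b t)) :=
    tendsto_nhdsWithin_of_tendsto_nhds hb.continuousAt.tendsto
  have h2 := (h1.smul hγ).add ((hasVelocityAt_iff_hasDerivAt.2 hb).smul_const (γ t))
  refine h2.congr fun s => ?_
  simp only [← Complex.coe_smul]
  module

theorem hasVelocityAt_line (x h : V) (t : ℝ) : HasVelocityAt (fun s : ℝ => x + s • h) h t := by
  refine tendsto_const_nhds.congr' ?_
  filter_upwards [self_mem_nhdsWithin] with s hs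
  rw [add_sub_add_left_eq_sub, ← sub_smul, smul_smul, inv_mul_cancel₀ (sub_ne_zero.2 hs), one_smul]

theorem mem_tangentSpaceOf_of_line {X : Set V} {x h : V} {ε : ℝ} (hε : 0 < ε)
    (hX : ∀ t ∈ Ioo (-ε) ε, x + t • h ∈ X) : h ∈ tangentSpaceOf X x :=
  ⟨ε, hε, fun t => x + t • h, fun _ => h,
    ⟨fun t ht => ⟨hX t ht, hasVelocityAt_line x h t⟩, continuousOn_const⟩, by simp, rfl⟩

theorem exists_line_mem_of_isOpen [IsTopologicalAddGroup V] [ContinuousSMul ℝ V] {X : Set V}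
    (hX : IsOpen X) {x : V} (hx : x ∈ X) (h : V) :
    ∃ ε > (0 : ℝ), ∀ t ∈ Ioo (-ε) ε, x + t • h ∈ X := by
  have hc : Continuous fun t : ℝ => x + t • h := by fun_prop
  have h0 : (fun t : ℝ => x + t • h) ⁻¹' X ∈ 𝓝 (0 : ℝ) :=
    hc.continuousAt (hX.mem_nhds (by simpa using hx))
  obtain ⟨ε, hε, hsub⟩ := Metric.mem_nhds_iff.1 h0
  refine ⟨ε, hε, fun t ht => hsub ?_⟩
  rwa [Real.ball_eq_Ioo, zero_sub, zero_add]

end Velocity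

section TangentSpaces

variable {r : ℝ} [hr : Fact (0 < r)]

theorem tangentSpaceOf_UnivS₀ {F : DiskFun₀ r} (hF : F ∈ UnivS₀ r) :
    tangentSpaceOf (UnivS₀ r) F = univ := by
  refine eq_univ_of_forall fun h => ?_
  obtain ⟨ε, hε, hX⟩ := exists_line_mem_of_isOpen isOpen_UnivS₀ hF h
  exact mem_tangentSpaceOf_of_line hε hX

theorem leadCoeff_real_smul (t : ℝ) (h : DiskFun₀ r) : leadCoeff (t • h) = t * leadCoeff h := by
  rw [← Complex.coe_smul, leadCoeff_smul]

/-- The normalization is an affine condition on the open set `S₀`: it is constant along paths in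
`S`, and segments in a direction with `h'(0) = 0` preserve it. -/
theorem tangentSpaceOf_UnivS {f : DiskFun₀ r} (hf : f ∈ UnivS r) :
    tangentSpaceOf (UnivS r) f = {h | leadCoeff h = 0} := by
  ext h
  constructor
  · rintro ⟨ε, hε, γ, γ', ⟨hγ, -⟩, rfl, rfl⟩
    have h0 : (0 : ℝ) ∈ Ioo (-ε) ε := ⟨by linarith, hε⟩
    have h1 := (hγ 0 h0).2.map (leadCoeffLinear r)
      (by simpa [← funext leadCoeffLinear_apply] using continuous_leadCoeff (r := r))
    simp only [leadCoeffLinear_apply] at h1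
    have h2 : HasDerivAt (fun s => leadCoeff (γ s)) 0 0 := by
      refine (hasDerivAt_const (0 : ℝ) (1 : ℂ)).congr_of_eventuallyEq ?_
      filter_upwards [Ioo_mem_nhds h0.1 h0.2] with s hs using (hγ s hs).1.2
    exact (hasVelocityAt_iff_hasDerivAt.1 h1).unique h2
  · intro hh
    obtain ⟨ε, hε, hX⟩ := exists_line_mem_of_isOpen isOpen_UnivS₀ hf.1 h
    refine mem_tangentSpaceOf_of_line hε fun t ht => ⟨hX t ht, ?_⟩
    rw [leadCoeff_add, leadCoeff_real_smul, hf.2, show leadCoeff h = 0 from hh, mul_zero, add_zero]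

end TangentSpaces

/-! ### The Löwner–Kufarev parametrization -/

section Basic

@[simp]
theorem lk_apply {r : ℝ} (f p : DiskFun r) (z : ℂ) : lk f p z = z * dz f z * p z := rfl

theorem lk_smul_left {r : ℝ} (c : ℂ) (f p : DiskFun r) : lk (c • f) p = c • lk f p := by
  refine DiskFun₀.ext_of_eqOn fun z _ => ?_
  have h1 : dz (c • f) z = c * dz f z := derivWithin_const_smul_field c f.1
  change z * dz (c • f) z * p z = c * (z * dz f z * p z)
  rw [h1]
  ring

theorem DiskFun.one_apply {r : ℝ} {z : ℂ} (hz : z ∈ closedBall (0 : ℂ) r) : DiskFun.one r z = 1 :=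
  indicator_of_mem hz fun _ => (1 : ℂ)

theorem rescale_apply (c : ℂ) {r s : ℝ} (h : ‖c‖ * s ≤ r) (f : DiskFun r) {z : ℂ}
    (hz : z ∈ closedBall (0 : ℂ) s) : rescale c h f z = f (c * z) :=
  indicator_of_mem hz fun z => f (c * z)

theorem mul_mem_closedDisk {c : ℂ} {r s : ℝ} (h : ‖c‖ * s ≤ r) {z : ℂ}
    (hz : z ∈ closedBall (0 : ℂ) s) : c * z ∈ closedBall (0 : ℂ) r := by
  rw [mem_closedBall_zero_iff] at hz ⊢
  rw [norm_mul]
  exact (mul_le_mul_of_nonneg_left hz (norm_nonneg c)).trans h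

theorem dz_rescale (c : ℂ) {r s : ℝ} (hs : 0 < s) (h : ‖c‖ * s ≤ r) (f : DiskFun r) {z : ℂ}
    (hz : z ∈ closedBall (0 : ℂ) s) : dz (rescale c h f) z = c * dz f (c * z) := by
  have h1 := (f.hasDerivWithinAt (mul_mem_closedDisk h hz)).scomp z
    ((hasDerivWithinAt_id z (closedBall (0 : ℂ) s)).const_mul c)
    fun w hw => mul_mem_closedDisk h hw
  rw [mul_one, smul_eq_mul] at h1
  exact (h1.congr (fun w hw => rescale_apply c h f hw) (rescale_apply c h f hz)).derivWithin
    (uniqueDiffOn_closedDisk hs z hz)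

end Basic

/-! ### Division by `z f'` -/

section LoewnerKufarev

variable {r : ℝ} [hr : Fact (0 < r)]

/-- At the origin the singularity is removable; everywhere else, boundary points included, the
quotient formula is visibly smooth. -/
theorem dslope_zero_contDiffOn (h : DiskFun r) :
    ContDiffOn ℂ ∞ (dslope h 0) (closedBall 0 r) := by
  intro z hz
  by_cases h0 : z = 0
  · subst h0
    have hb : ball (0 : ℂ) r ∈ 𝓝 (0 : ℂ) := ball_mem_nhds 0 hr.out
    have h1 := (Complex.differentiableOn_dslope hb).2 h.differentiableOn_ball
    exact (h1.contDiffOn isOpen_ball).contDiffAt hb |>.contDiffWithinAt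
  · have h1 : ContDiffWithinAt ℂ ∞ (fun w => (w - 0)⁻¹ * (h w - h 0)) (closedBall 0 r) z :=
      ((contDiffWithinAt_id.sub contDiffWithinAt_const).inv (by simpa using h0)).mul
        ((h.contDiffOn z hz).sub contDiffWithinAt_const)
    refine h1.congr_of_eventuallyEq ?_ ?_
    · filter_upwards [mem_nhdsWithin_of_mem_nhds (isOpen_ne.mem_nhds h0)] with w hw
      rw [dslope_of_ne _ hw, slope_def_field, div_eq_inv_mul]
    · rw [dslope_of_ne _ h0, slope_def_field, div_eq_inv_mul]

/-- The quotient `h(z) / z`, up to the boundary. -/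
noncomputable def divId (h : DiskFun₀ r) : DiskFun r :=
  ⟨(closedBall (0 : ℂ) r).indicator (dslope h 0),
    ⟨(dslope_zero_contDiffOn h.1).congr fun _ hz => indicator_of_mem hz _,
      fun _ hz => indicator_of_notMem hz _⟩⟩

theorem divId_eq_dslope (h : DiskFun₀ r) {z : ℂ} (hz : z ∈ closedBall (0 : ℂ) r) :
    divId h z = dslope h 0 z :=
  indicator_of_mem hz _

theorem mul_divId (h : DiskFun₀ r) {z : ℂ} (hz : z ∈ closedBall (0 : ℂ) r) :
    z * divId h z = h z := by
  have h1 := sub_smul_dslope (h : ℂ → ℂ) 0 z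
  rw [show (h : ℂ → ℂ) 0 = 0 from h.2, sub_zero, sub_zero, smul_eq_mul] at h1
  rw [divId_eq_dslope h hz, h1]

theorem divId_zero (h : DiskFun₀ r) : divId h 0 = leadCoeff h := by
  rw [divId_eq_dslope h zero_mem_closedDisk, dslope_same]
  rfl

/-- For identities obtained by cancelling a power of `z`: continuity supplies the missing value at
the origin. -/
theorem eq_zero_of_eqOn_ne_zero {g : ℂ → ℂ} (hg : ContinuousOn g (closedBall 0 r))
    (h : ∀ z ∈ closedBall (0 : ℂ) r, z ≠ 0 → g z = 0) : ∀ z ∈ closedBall (0 : ℂ) r, g z = 0 := by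
  intro z hz
  by_cases h0 : z = 0
  · subst h0
    have hb := closedDisk_mem_nhds (r := r) (mem_ball_self hr.out)
    have h1 : Tendsto g (𝓝[≠] 0) (𝓝 (g 0)) :=
      tendsto_nhdsWithin_of_tendsto_nhds (hg.continuousAt hb).tendsto
    refine tendsto_nhds_unique (h1.congr' ?_) tendsto_const_nhds
    filter_upwards [mem_nhdsWithin_of_mem_nhds hb, self_mem_nhdsWithin] with w hw hw0
      using h w hw hw0
  · exact h z hz h0

theorem lk_injective {f : DiskFun r} (hf : ∀ z ∈ closedBall (0 : ℂ) r, dz f z ≠ 0) :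
    Function.Injective (lk f) := by
  rw [injective_iff_map_eq_zero]
  intro p hp
  refine DiskFun.ext_of_eqOn (eq_zero_of_eqOn_ne_zero p.continuousOn fun z hz h0 => ?_)
  have h1 : z * dz f z * p z = 0 := congrFun (congrArg (fun g : DiskFun₀ r => g.1.1) hp) z
  exact (mul_eq_zero.1 h1).resolve_left (mul_ne_zero h0 (hf z hz))

theorem lk_surjective {f : DiskFun r} (hf : ∀ z ∈ closedBall (0 : ℂ) r, dz f z ≠ 0) :
    Function.Surjective (lk f) := by
  intro h
  -- Outside the disk the quotient is zero because its numerator is.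
  refine ⟨⟨fun z => divId h z / dz f z,
    ⟨(divId h).contDiffOn.div (dz_contDiffOn f) hf, fun z hz => by simp [(divId h).eq_zero hz]⟩⟩,
    DiskFun₀.ext_of_eqOn fun z hz => ?_⟩
  change z * dz f z * (divId h z / dz f z) = h z
  rw [mul_assoc, mul_div_cancel₀ _ (hf z hz), mul_divId h hz]

/-- Product rule for `z · (F' p)` at the origin. It converts conditions on `h'(0)` into conditions
on `p(0)`. -/
theorem leadCoeff_lk (F : DiskFun₀ r) (p : DiskFun r) :
    leadCoeff (lk F.1 p) = leadCoeff F * p 0 := by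
  have hm : (0 : ℂ) ∈ ball (0 : ℂ) r := mem_ball_self hr.out
  have hd : DifferentiableAt ℂ (fun z => dz F.1 z * p z) 0 :=
    ((((dz_contDiffOn F.1).mul p.contDiffOn).contDiffAt
      (closedDisk_mem_nhds hm)).differentiableAt (by simp))
  have h1 := (hasDerivAt_id (0 : ℂ)).mul hd.hasDerivAt
  have h2 : (lk F.1 p : ℂ → ℂ) = id * fun z => dz F.1 z * p z := by
    funext z
    simp [mul_assoc]
  rw [leadCoeff, h2, h1.deriv, leadCoeff_eq_dz]
  simp

theorem exists_lk_eq_of_leadCoeff_eq_zero {F : DiskFun₀ r} (hF : F ∈ UnivS₀ r) {h : DiskFun₀ r}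
    (hh : leadCoeff h = 0) : ∃ p : DiskFun r, lk F.1 p = h ∧ p 0 = 0 := by
  obtain ⟨p, hp⟩ := lk_surjective hF.2 h
  refine ⟨p, hp, ?_⟩
  have h1 := leadCoeff_lk F p
  rw [hp, hh] at h1
  exact (mul_eq_zero.1 h1.symm).resolve_left (leadCoeff_ne_zero hF)

theorem mem_ker_leadCoeffLinear {h : DiskFun₀ r} :
    h ∈ LinearMap.ker (leadCoeffLinear r) ↔ leadCoeff h = 0 := by
  rw [LinearMap.mem_ker, leadCoeffLinear_apply]

end LoewnerKufarev

instance fact_zero_lt_one_real : Fact ((0 : ℝ) < 1) := ⟨one_pos⟩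

/-! ### The two factorizations -/

section Factorizations

variable {F : DiskFun₀ 1}

theorem rhsF1_eq (F : DiskFun₀ 1) (p : DiskFun 1) :
    rhsF1 F p = (leadCoeff F)⁻¹ • (lk F.1 p - p 0 • F) := by
  have h1 : lk (factor₁ F).1 p = (leadCoeff F)⁻¹ • lk F.1 p := lk_smul_left _ _ _
  change lk (factor₁ F).1 p - p 0 • ((leadCoeff F)⁻¹ • F) = _
  rw [h1, smul_sub, smul_comm (p 0)]

theorem factor₁_mem (hF : F ∈ UnivS₀ 1) : factor₁ F ∈ UnivS 1 := by
  have ha := leadCoeff_ne_zero hF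
  refine ⟨⟨fun z hz w hw hzw => hF.1 hz hw ?_, fun z hz => ?_⟩, ?_⟩
  · exact mul_left_cancel₀ (inv_ne_zero ha) hzw
  · have h1 : dz (factor₁ F).1 z = (leadCoeff F)⁻¹ * dz F.1 z :=
      derivWithin_const_smul_field _ F.1.1
    rw [h1]
    exact mul_ne_zero (inv_ne_zero ha) (hF.2 z hz)
  · rw [factor₁, leadCoeff_smul, inv_mul_cancel₀ ha]

/-- Both `z F' p` and `p(0) F` have derivative `a₀ p(0)` at `0`, so their difference lies in the
hyperplane. Conversely, solving `z F' p = a₀ h` with `h'(0) = 0` forces `p(0) = 0`, and the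
correction term disappears. -/
theorem range_rhsF1 (hF : F ∈ UnivS₀ 1) :
    LinearMap.range (rhsF1 F) = LinearMap.ker (leadCoeffLinear 1) := by
  have ha := leadCoeff_ne_zero hF
  ext h
  rw [mem_ker_leadCoeffLinear]
  constructor
  · rintro ⟨p, rfl⟩
    rw [rhsF1_eq, leadCoeff_smul, sub_eq_add_neg, ← neg_smul, leadCoeff_add, leadCoeff_smul,
      leadCoeff_lk]
    ring
  · intro hh
    obtain ⟨p, hp, hp0⟩ := exists_lk_eq_of_leadCoeff_eq_zero hF
      (h := leadCoeff F • h) (by rw [leadCoeff_smul, hh, mul_zero])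
    refine ⟨p, ?_⟩
    rw [rhsF1_eq, hp, hp0, zero_smul, sub_zero, smul_smul, inv_mul_cancel₀ ha, one_smul]

theorem fact_norm_leadCoeff_pos (hF : F ∈ UnivS₀ 1) : Fact (0 < ‖leadCoeff F‖) :=
  ⟨norm_pos_iff.2 (leadCoeff_ne_zero hF)⟩

theorem factor₂_apply (F : DiskFun₀ 1) {z : ℂ} (hz : z ∈ closedBall (0 : ℂ) ‖leadCoeff F‖) :
    factor₂ F z = F ((leadCoeff F)⁻¹ * z) :=
  rescale_apply _ _ _ hz

theorem dz_factor₂ (hF : F ∈ UnivS₀ 1) {z : ℂ} (hz : z ∈ closedBall (0 : ℂ) ‖leadCoeff F‖) :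
    dz (factor₂ F).1 z = (leadCoeff F)⁻¹ * dz F.1 ((leadCoeff F)⁻¹ * z) :=
  dz_rescale _ (fact_norm_leadCoeff_pos hF).out _ _ hz

theorem factor₂_mem (hF : F ∈ UnivS₀ 1) : factor₂ F ∈ UnivS ‖leadCoeff F‖ := by
  have ha := leadCoeff_ne_zero hF
  have := fact_norm_leadCoeff_pos hF
  have hm : ∀ z ∈ closedBall (0 : ℂ) ‖leadCoeff F‖, (leadCoeff F)⁻¹ * z ∈ closedBall (0 : ℂ) 1 :=
    fun z hz => mul_mem_closedDisk (norm_inv_mul_norm_le_one _) hz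
  refine ⟨⟨fun z hz w hw hzw => ?_, fun z hz => ?_⟩, ?_⟩
  · rw [factor₂_apply F hz, factor₂_apply F hw] at hzw
    exact mul_left_cancel₀ (inv_ne_zero ha) (hF.1 (hm z hz) (hm w hw) hzw)
  · rw [dz_factor₂ hF hz]
    exact mul_ne_zero (inv_ne_zero ha) (hF.2 _ (hm z hz))
  · rw [leadCoeff_eq_dz, dz_factor₂ hF zero_mem_closedDisk, mul_zero, ← leadCoeff_eq_dz,
      inv_mul_cancel₀ ha]

theorem rhsF2_eq (F : DiskFun₀ 1) (p : DiskFun 1) :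
    rhsF2 F p = lk (factor₂ F).1 (rescale (leadCoeff F)⁻¹ (norm_inv_mul_norm_le_one _) p -
      p 0 • DiskFun.one _) := by
  rw [map_sub, map_smul]
  rfl

theorem rhsF2_apply (F : DiskFun₀ 1) (p : DiskFun 1) {z : ℂ}
    (hz : z ∈ closedBall (0 : ℂ) ‖leadCoeff F‖) :
    rhsF2 F p z = z * dz (factor₂ F).1 z * (p ((leadCoeff F)⁻¹ * z) - p 0) := by
  have h1 := rescale_apply _ (norm_inv_mul_norm_le_one (leadCoeff F)) p hz
  have h2 : DiskFun.one ‖leadCoeff F‖ z = 1 := DiskFun.one_apply hz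
  have h3 : ∀ q : DiskFun ‖leadCoeff F‖, (q - p 0 • DiskFun.one _ : DiskFun ‖leadCoeff F‖) z =
    q z - p 0 * DiskFun.one ‖leadCoeff F‖ z := fun _ => rfl
  rw [rhsF2_eq, ← h1]
  change z * dz (factor₂ F).1 z * (_ : DiskFun ‖leadCoeff F‖) z = _
  rw [h3, h2, mul_one]

theorem range_rhsF2 (hF : F ∈ UnivS₀ 1) : (LinearMap.range (rhsF2 F) : Set (DiskFun₀ _)) =
    {h : DiskFun₀ ‖leadCoeff F‖ | leadCoeff h = 0} := by
  have ha := leadCoeff_ne_zero hF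
  have := fact_norm_leadCoeff_pos hF
  have hf := factor₂_mem hF
  ext h
  constructor
  · rintro ⟨p, rfl⟩
    have h1 := rescale_apply _ (norm_inv_mul_norm_le_one (leadCoeff F)) p
      (zero_mem_closedDisk (r := ‖leadCoeff F‖))
    have h2 : DiskFun.one ‖leadCoeff F‖ 0 = 1 := DiskFun.one_apply zero_mem_closedDisk
    rw [mem_ofPred_eq, rhsF2_eq, leadCoeff_lk]
    change _ * (rescale _ _ p 0 - p 0 * DiskFun.one ‖leadCoeff F‖ 0) = 0
    rw [h1, h2, mul_zero]
    ring
  · intro hh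
    obtain ⟨q, hq, hq0⟩ := exists_lk_eq_of_leadCoeff_eq_zero hf.1 hh
    -- The solution `q` lives on `|z| ≤ |a₀|`; `p(z) = q(a₀ z)` undoes the rescaling.
    refine ⟨rescale (leadCoeff F) (mul_one _).le q, DiskFun₀.ext_of_eqOn fun z hz => ?_⟩
    have hm := mul_mem_closedDisk (norm_inv_mul_norm_le_one (leadCoeff F)) hz
    rw [rhsF2_apply F _ hz, rescale_apply _ _ _ hm, rescale_apply _ _ _ zero_mem_closedDisk,
      mul_zero, hq0, mul_inv_cancel_left₀ ha, sub_zero, ← hq]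
    rfl

theorem embed₂_apply (F : DiskFun₀ 1) (h : DiskFun₀ ‖leadCoeff F‖) {z : ℂ}
    (hz : z ∈ closedBall (0 : ℂ) 1) : embed₂ F h z = h (leadCoeff F * z) :=
  rescale_apply _ (mul_one ‖leadCoeff F‖).le h.1 hz

theorem embed₂_injective (hF : F ∈ UnivS₀ 1) : Function.Injective (embed₂ F) := by
  have ha := leadCoeff_ne_zero hF
  intro g h hgh
  refine DiskFun₀.ext_of_eqOn fun z hz => ?_
  have hm := mul_mem_closedDisk (norm_inv_mul_norm_le_one (leadCoeff F)) hz
  have h1 := embed₂_apply F g hm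
  rw [hgh, embed₂_apply F h hm, mul_inv_cancel_left₀ ha] at h1
  exact h1.symm

theorem sub_smul_one_apply (p : DiskFun 1) (c : ℂ) {z : ℂ} (hz : z ∈ closedBall (0 : ℂ) 1) :
    (p - c • DiskFun.one 1 : DiskFun 1) z = p z - c := by
  change p z - c * DiskFun.one 1 z = _
  rw [DiskFun.one_apply hz, mul_one]

/-- By the chain rule `a₀ z · f₂'(a₀ z) = z F'(z)`: the rescalings cancel. -/
theorem embed₂_rhsF2 (hF : F ∈ UnivS₀ 1) (p : DiskFun 1) :
    embed₂ F (rhsF2 F p) = lk F.1 (p - p 0 • DiskFun.one 1) := by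
  have ha := leadCoeff_ne_zero hF
  refine DiskFun₀.ext_of_eqOn fun z hz => ?_
  have hm := mul_mem_closedDisk (mul_one ‖leadCoeff F‖).le hz
  rw [embed₂_apply F _ hz, rhsF2_apply F p hm, dz_factor₂ hF hm, inv_mul_cancel_left₀ ha, lk_apply,
    sub_smul_one_apply p _ hz]
  field_simp

theorem dist₂_eq (hF : F ∈ UnivS₀ 1) : dist₂ F = LinearMap.ker (leadCoeffLinear 1) := by
  ext h
  rw [mem_ker_leadCoeffLinear]
  constructor
  · rintro ⟨_, ⟨p, rfl⟩, rfl⟩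
    rw [embed₂_rhsF2 hF, leadCoeff_lk, sub_smul_one_apply p _ zero_mem_closedDisk, sub_self,
      mul_zero]
  · intro hh
    obtain ⟨p, hp, hp0⟩ := exists_lk_eq_of_leadCoeff_eq_zero hF hh
    refine ⟨_, ⟨p, rfl⟩, ?_⟩
    rw [embed₂_rhsF2 hF, hp0, zero_smul, sub_zero, hp]

theorem rhsF1_eq_zero_iff (hF : F ∈ UnivS₀ 1) (p : DiskFun 1) :
    rhsF1 F p = 0 ↔ lk F.1 p = p 0 • F := by
  rw [rhsF1_eq, smul_eq_zero_iff_right (inv_ne_zero (leadCoeff_ne_zero hF)), sub_eq_zero]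

theorem rhsF2_eq_zero_iff (hF : F ∈ UnivS₀ 1) (p : DiskFun 1) :
    rhsF2 F p = 0 ↔ p = p 0 • DiskFun.one 1 := by
  rw [← map_eq_zero_iff _ (embed₂_injective hF), embed₂_rhsF2 hF,
    map_eq_zero_iff _ (lk_injective hF.2), sub_eq_zero]

theorem map_ker_rhsF1 (hF : F ∈ UnivS₀ 1) :
    (LinearMap.ker (rhsF1 F)).map (lk F.1) = Submodule.span ℂ {F} := by
  ext h
  rw [Submodule.mem_span_singleton]
  constructor
  · rintro ⟨p, hp, rfl⟩
    exact ⟨p 0, ((rhsF1_eq_zero_iff hF p).1 hp).symm⟩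
  · rintro ⟨c, rfl⟩
    obtain ⟨p, hp⟩ := lk_surjective hF.2 (c • F)
    -- Comparing derivatives at `0` in `z F' p = c F` gives `p(0) = c`, so `p` does lie in the
    -- kernel.
    have h1 := leadCoeff_lk F p
    rw [hp, leadCoeff_smul, mul_comm] at h1
    have h2 := mul_left_cancel₀ (leadCoeff_ne_zero hF) h1
    exact ⟨p, (rhsF1_eq_zero_iff hF p).2 (by rw [hp, h2]), hp⟩

theorem map_ker_rhsF2 (hF : F ∈ UnivS₀ 1) : (LinearMap.ker (rhsF2 F)).map (lk F.1) =
    Submodule.span ℂ {lk F.1 (DiskFun.one 1)} := by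
  have h1 : DiskFun.one 1 0 = 1 := DiskFun.one_apply zero_mem_closedDisk
  ext h
  rw [Submodule.mem_span_singleton]
  constructor
  · rintro ⟨p, hp, rfl⟩
    refine ⟨p 0, ?_⟩
    rw [← map_smul, ← (rhsF2_eq_zero_iff hF p).1 hp]
  · rintro ⟨c, rfl⟩
    refine ⟨c • DiskFun.one 1, (rhsF2_eq_zero_iff hF _).2 ?_, map_smul _ _ _⟩
    change _ = (c * DiskFun.one 1 0) • DiskFun.one 1
    rw [h1, mul_one]

/-- Write `F = z g`. Then `z F' = F` reads `z² g' = 0`, so `g` is constant, equal to `g(0) = a₀`. -/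
theorem eq_leadCoeff_mul_of_lk_one_eq (h : lk F.1 (DiskFun.one 1) = F) :
    ∀ z ∈ closedBall (0 : ℂ) 1, F z = leadCoeff F * z := by
  have hd : ∀ z ∈ closedBall (0 : ℂ) 1, dz (divId F) z = 0 := by
    refine eq_zero_of_eqOn_ne_zero (dz_contDiffOn _).continuousOn fun z hz h0 => ?_
    have h1 := ((hasDerivWithinAt_id z (closedBall (0 : ℂ) 1)).mul
      ((divId F).hasDerivWithinAt hz)).congr
      (f₁ := F) (fun w hw => (mul_divId F hw).symm) (mul_divId F hz).symm
    have h2 : dz F.1 z = _ := h1.derivWithin (uniqueDiffOn_closedDisk one_pos z hz)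
    have h3 : z * dz F.1 z * DiskFun.one 1 z = F z :=
      congrFun (congrArg (fun g : DiskFun₀ 1 => g.1.1) h) z
    rw [DiskFun.one_apply hz, ← mul_divId F hz, h2] at h3
    simp only [id] at h3
    have h4 : z * z * dz (divId F) z = 0 := by linear_combination h3
    exact (mul_eq_zero.1 h4).resolve_left (mul_ne_zero h0 h0)
  intro z hz
  have key := (convex_closedBall (0 : ℂ) 1).norm_image_sub_le_of_norm_hasDerivWithin_le
    (C := 0) (fun x hx => (divId F).hasDerivWithinAt hx) (fun x hx => by rw [hd x hx, norm_zero])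
    zero_mem_closedDisk hz
  rw [zero_mul, norm_le_zero_iff, sub_eq_zero, divId_zero] at key
  rw [← mul_divId F hz, key, mul_comm]

/-- The constant `1` always lies in the second kernel; it lies in the first exactly when `z F' = F`.
Given that identity, `z F' p = p(0) F` becomes `z F' p = z F' p(0)`, and injectivity makes the
kernels agree. -/
theorem ker_rhsF1_eq_ker_rhsF2_iff (hF : F ∈ UnivS₀ 1) :
    LinearMap.ker (rhsF1 F) = LinearMap.ker (rhsF2 F) ↔
      ∀ z ∈ closedBall (0 : ℂ) 1, F z = leadCoeff F * z := by
  have h1 : DiskFun.one 1 0 = 1 := DiskFun.one_apply zero_mem_closedDisk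
  constructor
  · intro h
    have h2 : DiskFun.one 1 ∈ LinearMap.ker (rhsF2 F) :=
      (rhsF2_eq_zero_iff hF _).2 (by rw [h1, one_smul])
    rw [← h] at h2
    have h3 := (rhsF1_eq_zero_iff hF _).1 h2
    rw [h1, one_smul] at h3
    exact eq_leadCoeff_mul_of_lk_one_eq h3
  · intro h
    have h2 : lk F.1 (DiskFun.one 1) = F := by
      refine DiskFun₀.ext_of_eqOn fun z hz => ?_
      have h3 : dz F.1 z = leadCoeff F := by
        have h4 := (((hasDerivWithinAt_id z (closedBall (0 : ℂ) 1)).const_mul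
          (leadCoeff F)).congr (f₁ := F) h (h z hz)).derivWithin
          (uniqueDiffOn_closedDisk one_pos z hz)
        rwa [mul_one] at h4
      rw [lk_apply, DiskFun.one_apply hz, h3, h z hz]
      ring
    ext p
    rw [LinearMap.mem_ker, LinearMap.mem_ker, rhsF1_eq_zero_iff hF, rhsF2_eq_zero_iff hF,
      ← (lk_injective hF.2).eq_iff, map_smul, h2]

end Factorizations

/-! ### Constant sub-bundles -/

/-- The differential `(x, v) ↦ g v` is again continuous and linear, now on `V × V`; hence the
induction over varying `V`. -/
theorem isCkOn_linear (n : ℕ) {V W : Type} [AddCommGroup V] [Module ℂ V] [TopologicalSpace V]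
    [AddCommGroup W] [Module ℂ W] [TopologicalSpace W] (g : V →ₗ[ℂ] W) (hg : Continuous g)
    (U : Set V) : IsCkOn n g U := by
  induction n generalizing V with
  | zero => exact hg.continuousOn
  | succ n ih =>
    refine ⟨hg.continuousOn, g ∘ₗ LinearMap.snd ℂ V V, fun x _ v => ?_,
      ih (g ∘ₗ LinearMap.snd ℂ V V) (hg.comp continuous_snd) _⟩
    refine tendsto_const_nhds.congr' ?_
    filter_upwards [self_mem_nhdsWithin] with t ht
    have ht : (t : ℂ) ≠ 0 := Complex.ofReal_ne_zero.2 ht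
    simp only [← Complex.coe_smul, map_add, map_smul, add_sub_cancel_left, smul_smul,
      Complex.ofReal_inv, inv_mul_cancel₀ ht, one_smul]
    rfl

theorem isCodimOneSubbundle_of_eq_ker {V : Type} [AddCommGroup V] [Module ℂ V] [TopologicalSpace V]
    {X : Set V} (hX : IsOpen X) {D : V → Submodule ℂ V} (L : V →ₗ[ℂ] ℂ) (hL : Continuous L)
    (hsurj : Function.Surjective L) (hD : ∀ x ∈ X, D x = LinearMap.ker L) :
    IsCodimOneSubbundle X D where
  isOpen_base := hX
  isClosed_fibre x hx := by
    rw [hD x hx]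
    exact isClosed_singleton.preimage hL
  codim_fibre x hx := by
    rw [hD x hx, (L.quotKerEquivOfSurjective hsurj).finrank_eq, Module.finrank_self]
  locally_trivial x hx := by
    -- The fibres do not depend on the base point, so the identity trivializes over all of `X`.
    refine ⟨X, hX, hx, Subset.rfl, fun _ => LinearEquiv.refl ℂ V, fun y hy => ?_, fun n => ?_,
      fun n => ?_⟩
    · rw [hD x hx, hD y hy]
      exact Submodule.map_id _
    · exact isCkOn_linear n (LinearMap.snd ℂ V V) continuous_snd _
    · exact isCkOn_linear n (LinearMap.snd ℂ V V) continuous_snd _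

theorem continuous_leadCoeffLinear {r : ℝ} [Fact (0 < r)] : Continuous (leadCoeffLinear r) := by
  simpa [← funext leadCoeffLinear_apply] using continuous_leadCoeff (r := r)

theorem isCodimOneSubbundle_of_eq_ker_leadCoeff {D : DiskFun₀ 1 → Submodule ℂ (DiskFun₀ 1)}
    (hD : ∀ F ∈ UnivS₀ 1, D F = LinearMap.ker (leadCoeffLinear 1)) :
    IsCodimOneSubbundle (UnivS₀ 1) D := by
  refine isCodimOneSubbundle_of_eq_ker isOpen_UnivS₀ (leadCoeffLinear 1)
    continuous_leadCoeffLinear ?_ hD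
  -- The function `z` has derivative `1` at the origin, so the functional is onto.
  let e : DiskFun 1 := ⟨(closedBall (0 : ℂ) 1).indicator id,
    ⟨contDiffOn_id.congr fun _ hz => indicator_of_mem hz _, fun _ hz => indicator_of_notMem hz _⟩⟩
  let e₀ : DiskFun₀ 1 := ⟨e, indicator_of_mem zero_mem_closedDisk _⟩
  have h1 : leadCoeff e₀ = 1 := by
    have h2 : (e₀ : ℂ → ℂ) =ᶠ[𝓝 0] id := by
      filter_upwards [closedDisk_mem_nhds (mem_ball_self one_pos)] with z hz
        using indicator_of_mem hz _
    rw [leadCoeff, h2.deriv_eq, deriv_id]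
  intro c
  exact ⟨c • e₀, by rw [leadCoeffLinear_apply, leadCoeff_smul, h1, mul_one]⟩

/-! ### Paths of univalent functions -/

section Paths

variable {γ : ℝ → DiskFun₀ 1} {p : DiskFun 1} {t : ℝ}

theorem hasDerivAt_leadCoeff (hγ : HasVelocityAt γ (lk (γ t).1 p) t) :
    HasDerivAt (fun s => leadCoeff (γ s)) (p 0 * leadCoeff (γ t)) t := by
  have h1 := hγ.map (leadCoeffLinear 1) continuous_leadCoeffLinear
  simp only [leadCoeffLinear_apply, leadCoeff_lk] at h1
  rw [mul_comm]
  exact hasVelocityAt_iff_hasDerivAt.1 h1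

theorem hasVelocityAt_factor₁ (hF : γ t ∈ UnivS₀ 1) (hγ : HasVelocityAt γ (lk (γ t).1 p) t) :
    HasVelocityAt (fun s => factor₁ (γ s)) (rhsF1 (γ t) p) t := by
  have ha := leadCoeff_ne_zero hF
  have h1 := HasVelocityAt.smul ((hasDerivAt_leadCoeff hγ).fun_inv ha) hγ
  have h2 : rhsF1 (γ t) p = (leadCoeff (γ t))⁻¹ • lk (γ t).1 p +
      (-(p 0 * leadCoeff (γ t)) / leadCoeff (γ t) ^ 2) • γ t := by
    rw [rhsF1_eq, smul_sub, sub_eq_add_neg, smul_smul, ← neg_smul]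
    congr 2
    field_simp
  rw [h2]
  exact h1

/-- The difference quotient splits into that of `γ`, evaluated at the moving point `c s`, and that
of `γ t ∘ c`. Uniform convergence on the disk handles the first, the chain rule the second. -/
theorem hasDerivAt_eval_comp {γ : ℝ → DiskFun₀ 1} {h : DiskFun₀ 1} {t : ℝ}
    (hγ : HasVelocityAt γ h t) {c : ℝ → ℂ} {c' : ℂ} (hc : HasDerivAt c c' t)
    (hct : c t ∈ ball (0 : ℂ) 1) :
    HasDerivAt (fun s => γ s (c s)) (h (c t) + dz (γ t).1 (c t) * c') t := by
  have : CompactSpace (closedBall (0 : ℂ) 1) :=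
    isCompact_iff_compactSpace.1 (isCompact_closedBall 0 1)
  have hball : ∀ᶠ s in 𝓝[≠] t, c s ∈ ball (0 : ℂ) 1 :=
    mem_nhdsWithin_of_mem_nhds (hc.continuousAt (isOpen_ball.mem_nhds hct))
  have hjet : Continuous fun G : DiskFun₀ 1 => DiskFun.jet 1 0 G.1 :=
    (DiskFun.continuous_jet 1 0).comp continuous_subtype_val
  have h0 : ∀ (G : DiskFun 1) (z : closedBall (0 : ℂ) 1), DiskFun.jet 1 0 G z = G z :=
    fun G z => congrFun (iteratedDerivWithin_zero (f := G.1) (s := closedBall 0 1)) z.1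
  have h1 : Tendsto (fun s : ℝ => ((s - t)⁻¹ • (γ s - γ t) : DiskFun₀ 1) (c s) - h (c s))
      (𝓝[≠] t) (𝓝 0) := by
    have h2 := ((hjet.tendsto h).comp hγ).sub_const (DiskFun.jet 1 0 h.1)
    rw [sub_self] at h2
    refine squeeze_zero_norm' ?_ (tendsto_zero_iff_norm_tendsto_zero.1 h2)
    filter_upwards [hball] with s hs
    have h3 := ContinuousMap.norm_coe_le_norm
      (DiskFun.jet 1 0 ((s - t)⁻¹ • (γ s - γ t) : DiskFun₀ 1).1 - DiskFun.jet 1 0 h.1)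
      ⟨c s, ball_subset_closedBall hs⟩
    rwa [ContinuousMap.sub_apply, h0, h0] at h3
  have h2 : Tendsto (fun s => h (c s)) (𝓝[≠] t) (𝓝 (h (c t))) :=
    tendsto_nhdsWithin_of_tendsto_nhds
      ((h.1.hasDerivAt hct).continuousAt.comp hc.continuousAt).tendsto
  have h3 : Tendsto (slope (fun s => γ t (c s)) t) (𝓝[≠] t) (𝓝 (dz (γ t).1 (c t) * c')) :=
    hasDerivAt_iff_tendsto_slope.1 ((((γ t).1.hasDerivAt hct).comp t hc))
  rw [hasDerivAt_iff_tendsto_slope]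
  have h4 := (h1.add h2).add h3
  rw [zero_add] at h4
  refine h4.congr fun s => ?_
  have h5 : ((s - t)⁻¹ • (γ s - γ t) : DiskFun₀ 1) (c s) =
      (((s - t)⁻¹ : ℝ) : ℂ) * (γ s (c s) - γ t (c s)) := rfl
  rw [h5, slope_def_module, slope_def_module, Complex.real_smul, Complex.real_smul]
  ring

/-- The domain of `f₂` changes with time, so the derivative is taken at a fixed interior point. The
moving argument `z / a₀` contributes the term `-u₀ z f₂'`. -/
theorem hasDerivAt_factor₂ (hF : γ t ∈ UnivS₀ 1) (hγ : HasVelocityAt γ (lk (γ t).1 p) t) {z : ℂ}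
    (hz : ‖z‖ < ‖leadCoeff (γ t)‖) :
    HasDerivAt (fun s => factor₂ (γ s) z) (rhsF2 (γ t) p z) t := by
  have ha := leadCoeff_ne_zero hF
  have hlead := hasDerivAt_leadCoeff hγ
  have hc := (hlead.fun_inv ha).mul_const z
  have hct : (leadCoeff (γ t))⁻¹ * z ∈ ball (0 : ℂ) 1 := by
    rw [mem_ball_zero_iff, norm_mul, norm_inv, inv_mul_lt_one₀ (norm_pos_iff.2 ha)]
    exact hz
  have h1 := hasDerivAt_eval_comp hγ hc hct
  have hz' : z ∈ closedBall (0 : ℂ) ‖leadCoeff (γ t)‖ := mem_closedBall_zero_iff.2 hz.le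
  -- For `s` near `t` the point `z` still lies in the disk of radius `|a₀(s)|`, where `f₂` is not
  -- cut off to zero.
  have h2 : (fun s => factor₂ (γ s) z) =ᶠ[𝓝 t] fun s => γ s ((leadCoeff (γ s))⁻¹ * z) := by
    filter_upwards [hlead.continuousAt.norm.eventually (lt_mem_nhds hz)] with s hs
      using factor₂_apply _ (mem_closedBall_zero_iff.2 hs.le)
  refine (h1.congr_of_eventuallyEq h2).congr_deriv ?_
  rw [rhsF2_apply _ p hz', dz_factor₂ hF hz', lk_apply]
  field_simp
  ring

end Paths

/-! ### Power series with rapidly decreasing coefficients -/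

section RapidDecay

/-- The sequence `u` decreases faster than every power. -/
def RapidDecay (u : ℕ → ℂ) : Prop := ∀ k : ℕ, Summable fun n : ℕ => (n : ℝ) ^ k * ‖u n‖

theorem RapidDecay.summable_norm {u : ℕ → ℂ} (hu : RapidDecay u) : Summable fun n => ‖u n‖ := by
  simpa using hu 0

theorem RapidDecay.const_mul {u : ℕ → ℂ} (hu : RapidDecay u) (c : ℂ) :
    RapidDecay fun n => c * u n := by
  intro k
  refine ((hu k).mul_left ‖c‖).congr fun n => ?_
  rw [norm_mul]
  ring

/-- The coefficients of the derivative of a power series. -/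
def derivCoeffs (u : ℕ → ℂ) (n : ℕ) : ℂ := (n + 1) * u (n + 1)

theorem RapidDecay.derivCoeffs {u : ℕ → ℂ} (hu : RapidDecay u) : RapidDecay (derivCoeffs u) := by
  intro k
  refine Summable.of_nonneg_of_le (fun n => by positivity) (fun n => ?_)
    ((summable_nat_add_iff 1).2 (hu (k + 1)))
  have h1 : ‖_root_.derivCoeffs u n‖ = ((n + 1 : ℕ) : ℝ) * ‖u (n + 1)‖ := by
    rw [_root_.derivCoeffs, norm_mul]
    congr 1
    rw [← Nat.cast_succ, Complex.norm_natCast]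
  rw [h1, pow_succ, mul_assoc]
  refine mul_le_mul_of_nonneg_right ?_ (by positivity)
  exact pow_le_pow_left₀ (by positivity) (by push_cast; linarith) k

/-- The sum of the power series with coefficients `u`. -/
noncomputable def powerSum (u : ℕ → ℂ) (z : ℂ) : ℂ := ∑' n, u n * z ^ n

theorem summable_powerSum {u : ℕ → ℂ} (hu : Summable fun n => ‖u n‖) {z : ℂ} (hz : ‖z‖ ≤ 1) :
    Summable fun n => u n * z ^ n := by
  refine Summable.of_norm_bounded hu fun n => ?_
  rw [norm_mul, norm_pow]
  exact mul_le_of_le_one_right (norm_nonneg _) (pow_le_one₀ (norm_nonneg _) hz)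

theorem powerSum_zero (u : ℕ → ℂ) : powerSum u 0 = u 0 := by
  rw [powerSum, tsum_eq_single 0 fun n hn => by rw [zero_pow hn, mul_zero], pow_zero, mul_one]

/-- First-order Taylor remainder of a power. The bound is polynomial in the exponent, so it can be
summed against rapidly decreasing coefficients. -/
theorem norm_pow_sub_pow_sub_le {z w : ℂ} (hz : ‖z‖ ≤ 1) (hw : ‖w‖ ≤ 1) (n : ℕ) :
    ‖z ^ (n + 1) - w ^ (n + 1) - (n + 1) * w ^ n * (z - w)‖ ≤ ((n + 1 : ℕ) : ℝ) ^ 2 * ‖z - w‖ ^ 2 := by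
  induction n with
  | zero => simp
  | succ n ih =>
    have e : z ^ (n + 1 + 1) - w ^ (n + 1 + 1) - ((n + 1 : ℕ) + 1) * w ^ (n + 1) * (z - w) =
        z * (z ^ (n + 1) - w ^ (n + 1) - (n + 1) * w ^ n * (z - w)) +
          (n + 1 : ℕ) * (w ^ n * ((z - w) * (z - w))) := by
      push_cast
      ring
    rw [e]
    refine (norm_add_le _ _).trans ?_
    rw [norm_mul, norm_mul, norm_mul, norm_mul, norm_pow, Complex.norm_natCast, ← sq ‖z - w‖]
    have h1 := mul_le_of_le_one_left (norm_nonneg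
      (z ^ (n + 1) - w ^ (n + 1) - (n + 1) * w ^ n * (z - w))) hz
    have h2 : ‖w‖ ^ n * ‖z - w‖ ^ 2 ≤ ‖z - w‖ ^ 2 :=
      mul_le_of_le_one_left (by positivity) (pow_le_one₀ (norm_nonneg _) hw)
    have h3 := mul_le_mul_of_nonneg_left h2 (Nat.cast_nonneg (α := ℝ) (n + 1))
    push_cast at h3 ih ⊢
    nlinarith [sq_nonneg ‖z - w‖, Nat.cast_nonneg (α := ℝ) n]

/-- Summing the remainders of the powers gives an error `O(|z - w|²)` on the whole closed disk, so
termwise differentiation reaches the boundary circle. -/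
theorem hasDerivWithinAt_powerSum {u : ℕ → ℂ} (hu : RapidDecay u) {w : ℂ}
    (hw : w ∈ closedBall (0 : ℂ) 1) :
    HasDerivWithinAt (powerSum u) (powerSum (derivCoeffs u) w) (closedBall 0 1) w := by
  set C := ∑' n : ℕ, ((n + 1 : ℕ) : ℝ) ^ 2 * ‖u (n + 1)‖
  have hC := (summable_nat_add_iff 1).2 (hu 2)
  have hw' := mem_closedBall_zero_iff.1 hw
  have key : ∀ z ∈ closedBall (0 : ℂ) 1,
      ‖powerSum u z - powerSum u w - (z - w) • powerSum (derivCoeffs u) w‖ ≤ C * ‖z - w‖ ^ 2 := by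
    intro z hz
    have hz' := mem_closedBall_zero_iff.1 hz
    have s1 := summable_powerSum hu.summable_norm hz'
    have s2 := summable_powerSum hu.summable_norm hw'
    have s3 := summable_powerSum hu.derivCoeffs.summable_norm hw'
    have e : powerSum u z - powerSum u w - (z - w) • powerSum (derivCoeffs u) w =
        ∑' n : ℕ, u (n + 1) *
          (z ^ (n + 1) - w ^ (n + 1) - (n + 1) * w ^ n * (z - w)) := by
      rw [powerSum, powerSum, powerSum, s1.tsum_eq_zero_add, s2.tsum_eq_zero_add, smul_eq_mul,
        ← tsum_mul_left, pow_zero, pow_zero, add_sub_add_left_eq_sub,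
        ← ((summable_nat_add_iff 1).2 s1).tsum_sub ((summable_nat_add_iff 1).2 s2),
        ← (((summable_nat_add_iff 1).2 s1).sub ((summable_nat_add_iff 1).2 s2)).tsum_sub
          (s3.mul_left _)]
      refine tsum_congr fun n => ?_
      rw [derivCoeffs]
      ring
    rw [e, ← tsum_mul_right]
    refine tsum_of_norm_bounded (hC.mul_right _).hasSum fun n => ?_
    rw [norm_mul]
    calc _ ≤ ‖u (n + 1)‖ * (((n + 1 : ℕ) : ℝ) ^ 2 * ‖z - w‖ ^ 2) :=
          mul_le_mul_of_nonneg_left (norm_pow_sub_pow_sub_le hz' hw' n) (norm_nonneg _)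
      _ = _ := by ring
  rw [hasDerivWithinAt_iff_isLittleO]
  have hO : (fun z => powerSum u z - powerSum u w - (z - w) • powerSum (derivCoeffs u) w)
      =O[𝓝[closedBall 0 1] w] fun z => ‖z - w‖ ^ 2 := by
    refine Asymptotics.IsBigO.of_bound C ?_
    filter_upwards [self_mem_nhdsWithin] with z hz
    rw [norm_pow, norm_norm]
    exact key z hz
  refine hO.trans_isLittleO (Asymptotics.IsLittleO.mono ?_ nhdsWithin_le_nhds)
  have h1 : Tendsto (fun z : ℂ => z - w) (𝓝 w) (𝓝 0) := by
    simpa using (continuous_sub_right w).tendsto w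
  exact ((Asymptotics.isLittleO_norm_pow_id one_lt_two).comp_tendsto h1)

theorem derivWithin_powerSum {u : ℕ → ℂ} (hu : RapidDecay u) :
    EqOn (derivWithin (powerSum u) (closedBall 0 1)) (powerSum (derivCoeffs u)) (closedBall 0 1) :=
  fun w hw => (hasDerivWithinAt_powerSum hu hw).derivWithin (uniqueDiffOn_closedDisk one_pos w hw)

theorem contDiffOn_powerSum {u : ℕ → ℂ} (hu : RapidDecay u) :
    ContDiffOn ℂ ∞ (powerSum u) (closedBall 0 1) := by
  rw [contDiffOn_infty]
  intro k
  induction k generalizing u with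
  | zero => exact contDiffOn_zero.2 fun w hw => (hasDerivWithinAt_powerSum hu hw).continuousWithinAt
  | succ k ih =>
    rw [Nat.cast_succ, contDiffOn_succ_iff_derivWithin (uniqueDiffOn_closedDisk one_pos)]
    exact ⟨fun w hw => (hasDerivWithinAt_powerSum hu hw).differentiableWithinAt, by simp,
      (ih hu.derivCoeffs).congr (derivWithin_powerSum hu)⟩

theorem iteratedDerivWithin_powerSum_zero {u : ℕ → ℂ} (hu : RapidDecay u) (n : ℕ) :
    iteratedDerivWithin n (powerSum u) (closedBall 0 1) 0 = n.factorial * u n := by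
  induction n generalizing u with
  | zero => simp [powerSum_zero]
  | succ n ih =>
    rw [iteratedDerivWithin_succ',
      iteratedDerivWithin_congr (derivWithin_powerSum hu) zero_mem_closedDisk,
      ih hu.derivCoeffs, derivCoeffs, Nat.factorial_succ]
    push_cast
    ring

/-- The function on the closed unit disk with given rapidly decreasing Taylor coefficients. -/
noncomputable def DiskFun.ofCoeffs (u : ℕ → ℂ) (hu : RapidDecay u) : DiskFun 1 :=
  ⟨(closedBall (0 : ℂ) 1).indicator (powerSum u),
    ⟨(contDiffOn_powerSum hu).congr fun _ hz => indicator_of_mem hz _,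
      fun _ hz => indicator_of_notMem hz _⟩⟩

theorem DiskFun.ofCoeffs_apply {u : ℕ → ℂ} (hu : RapidDecay u) {z : ℂ}
    (hz : z ∈ closedBall (0 : ℂ) 1) : DiskFun.ofCoeffs u hu z = powerSum u z :=
  indicator_of_mem hz _

theorem DiskFun.coeff_ofCoeffs {u : ℕ → ℂ} (hu : RapidDecay u) (n : ℕ) :
    coeff (DiskFun.ofCoeffs u hu) n = u n := by
  rw [coeff_eq_iteratedDerivWithin,
    iteratedDerivWithin_congr (fun z hz => DiskFun.ofCoeffs_apply hu hz) zero_mem_closedDisk,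
    iteratedDerivWithin_powerSum_zero hu, mul_div_cancel_left₀]
  exact_mod_cast n.factorial_ne_zero

end RapidDecay

/-! ### Fourier series of smooth periodic functions -/

section Fourier

variable {φ : ℝ → ℝ}

/-- The complex Fourier coefficient `a_n - i b_n`. -/
noncomputable def fourierComplex (φ : ℝ → ℝ) (n : ℕ) : ℂ := fourierCos φ n - Complex.I * fourierSin φ n

theorem circleMap_pow (θ : ℝ) (n : ℕ) :
    circleMap 0 1 θ ^ n = Real.cos (n * θ) + Real.sin (n * θ) * Complex.I := by
  rw [circleMap_zero, Complex.ofReal_one, one_mul, ← Complex.exp_nat_mul, ← mul_assoc,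
    Complex.exp_mul_I]
  push_cast
  ring

/-- Thus `Jφ` is minus the imaginary part of the series `∑ (a_n - i b_n) e^{inθ}`, whose real part
is `φ`. -/
theorem conjTerm_eq_im (φ : ℝ → ℝ) (n : ℕ) (θ : ℝ) :
    conjTerm φ n θ = -(fourierComplex φ n * circleMap 0 1 θ ^ n).im := by
  rw [circleMap_pow, fourierComplex, conjTerm]
  simp [-Complex.ofReal_cos, -Complex.ofReal_sin, add_comm]

theorem fourierComplex_deriv (hφ : ContDiff ℝ ∞ φ) (hp : Function.Periodic φ (2 * Real.pi))
    (n : ℕ) : fourierComplex (deriv φ) n = Complex.I * n * fourierComplex φ n := by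
  rw [fourierComplex, fourierComplex, fourierCos_deriv hφ hp, fourierSin_deriv hφ]
  push_cast
  linear_combination (n * fourierSin φ n : ℂ) * Complex.I_mul_I

theorem exists_norm_fourierComplex_le (hφ : Continuous φ) : ∃ C, ∀ n, ‖fourierComplex φ n‖ ≤ C := by
  obtain ⟨C, hC⟩ := exists_fourier_bound hφ
  refine ⟨C + C, fun n => (norm_sub_le _ _).trans ?_⟩
  rw [norm_mul, Complex.norm_I, one_mul, Complex.norm_real, Complex.norm_real]
  exact add_le_add (hC n).1 (hC n).2

theorem exists_pow_mul_norm_fourierComplex_le (k : ℕ) (hφ : ContDiff ℝ ∞ φ)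
    (hp : Function.Periodic φ (2 * Real.pi)) :
    ∃ C, ∀ n : ℕ, (n : ℝ) ^ k * ‖fourierComplex φ n‖ ≤ C := by
  induction k generalizing φ with
  | zero => simpa using exists_norm_fourierComplex_le hφ.continuous
  | succ k ih =>
    obtain ⟨C, hC⟩ := ih (contDiff_deriv_of_contDiff hφ) (periodic_deriv hp)
    refine ⟨C, fun n => ?_⟩
    have h1 := hC n
    rwa [fourierComplex_deriv hφ hp, norm_mul, norm_mul, Complex.norm_I, one_mul,
      Complex.norm_natCast, ← mul_assoc, ← pow_succ] at h1

theorem rapidDecay_fourierComplex (hφ : ContDiff ℝ ∞ φ) (hp : Function.Periodic φ (2 * Real.pi)) :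
    RapidDecay (fourierComplex φ) := by
  intro k
  -- Two extra powers leave a factor `1 / n²`, which is summable.
  obtain ⟨C, hC⟩ := exists_pow_mul_norm_fourierComplex_le (k + 2) hφ hp
  rw [← summable_nat_add_iff 1]
  refine Summable.of_nonneg_of_le (fun n => by positivity) (fun n => ?_)
    (((summable_nat_add_iff 1).2 (Real.summable_one_div_nat_pow.2 one_lt_two)).mul_left C)
  have h1 := hC (n + 1)
  have hn : (0 : ℝ) < ((n + 1 : ℕ) : ℝ) ^ 2 := by positivity
  rw [mul_one_div, le_div_iff₀ hn]
  calc _ = ((n + 1 : ℕ) : ℝ) ^ (k + 2) * ‖fourierComplex φ (n + 1)‖ := by ring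
    _ ≤ C := h1

theorem fourierComplex_eq_integral (hφ : Continuous φ) (n : ℕ) :
    fourierComplex φ n = (Real.pi : ℂ)⁻¹ * ∫ θ in (0 : ℝ)..2 * Real.pi,
      (starRingEnd ℂ) (circleMap 0 1 θ ^ n) * φ θ := by
  have h1 : ∀ θ : ℝ, (starRingEnd ℂ) (circleMap 0 1 θ ^ n) * φ θ =
      ((φ θ * Real.cos (n * θ) : ℝ) : ℂ) - Complex.I * ((φ θ * Real.sin (n * θ) : ℝ) : ℂ) := by
    intro θ
    rw [circleMap_pow, map_add, map_mul, Complex.conj_ofReal, Complex.conj_ofReal, Complex.conj_I]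
    push_cast
    ring
  simp_rw [h1]
  rw [intervalIntegral.integral_sub (Continuous.intervalIntegrable (by fun_prop) _ _)
    (Continuous.intervalIntegrable (by fun_prop) _ _), intervalIntegral.integral_const_mul,
    intervalIntegral.integral_ofReal, intervalIntegral.integral_ofReal, fourierComplex, fourierCos,
    fourierSin]
  push_cast
  ring

theorem fourier_coe_eq_circleMap_pow (n : ℕ) (θ : ℝ) :
    fourier (n : ℤ) (θ : AddCircle (2 * Real.pi)) = circleMap 0 1 θ ^ n := by
  rw [fourier_coe_apply, circleMap_zero, Complex.ofReal_one, one_mul, ← Complex.exp_nat_mul]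
  congr 1
  push_cast
  field_simp

/-- A smooth periodic function of mean value zero is the sum of its Fourier series. -/
theorem hasSum_re_fourierComplex (hφ : ContDiff ℝ ∞ φ) (hp : Function.Periodic φ (2 * Real.pi))
    (h0 : ∫ θ in (0 : ℝ)..2 * Real.pi, φ θ = 0) (θ : ℝ) :
    HasSum (fun n : ℕ => ((fourierComplex φ n * circleMap 0 1 θ ^ n).re : ℂ)) (φ θ) := by
  have : Fact (0 < 2 * Real.pi) := ⟨Real.two_pi_pos⟩
  have hpi : (Real.pi : ℂ) ≠ 0 := Complex.ofReal_ne_zero.2 Real.pi_ne_zero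
  have hper : Function.Periodic (fun θ => (φ θ : ℂ)) (2 * Real.pi) := fun x => congrArg _ (hp x)
  let f : C(AddCircle (2 * Real.pi), ℂ) := ⟨hper.lift, by
    refine continuous_coinduced_dom.2 ?_
    exact Complex.continuous_ofReal.comp hφ.continuous⟩
  have hf : ∀ x : ℝ, f x = φ x := fun x => hper.lift_coe x
  -- The half comes from the normalizations `1 / (2π)` and `1 / π`.
  have hneg : ∀ n : ℕ, fourierCoeff f n = fourierComplex φ n / 2 := by
    intro n
    rw [fourierCoeff_eq_intervalIntegral _ _ 0, fourierComplex_eq_integral hφ.continuous, zero_add]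
    simp_rw [fourier_neg, fourier_coe_eq_circleMap_pow, hf, smul_eq_mul, Complex.real_smul]
    push_cast
    field_simp
  -- Since `φ` is real, opposite frequencies have conjugate coefficients; pairing `n` with `-n` then
  -- yields real parts.
  have hpos : ∀ n : ℕ, fourierCoeff f (-n) = (starRingEnd ℂ) (fourierComplex φ n) / 2 := by
    intro n
    rw [fourierCoeff_eq_intervalIntegral _ _ 0, fourierComplex_eq_integral hφ.continuous, zero_add,
      map_mul, ← intervalIntegral_conj]
    simp_rw [neg_neg, fourier_coe_eq_circleMap_pow, hf, smul_eq_mul, Complex.real_smul, map_mul,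
      Complex.conj_conj, Complex.conj_ofReal, map_inv₀, Complex.conj_ofReal]
    push_cast
    field_simp
  have hsum := (rapidDecay_fourierComplex hφ hp).summable_norm
  have hs : Summable (fourierCoeff f) := by
    refine Summable.of_norm (Summable.of_nat_of_neg ?_ ?_)
    · refine (hsum.div_const 2).congr fun n => ?_
      rw [hneg, norm_div, Complex.norm_two]
    · refine (hsum.div_const 2).congr fun n => ?_
      rw [hpos, norm_div, Complex.norm_two, Complex.norm_conj]
  have h1 := (has_pointwise_sum_fourier_series_of_summable hs (θ : AddCircle (2 * Real.pi))).nat_add_neg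
  -- The pairing counts frequency `0` twice, which is harmless because the mean vanishes.
  have h2 : fourierCoeff f 0 = 0 := by
    have h3 := hneg 0
    rw [fourierComplex, fourierCos, fourierSin] at h3
    simpa [h0] using h3
  rw [h2, zero_smul, add_zero, hf] at h1
  convert h1 using 2 with n
  rw [hneg, hpos, fourier_neg, fourier_coe_eq_circleMap_pow, smul_eq_mul, smul_eq_mul,
    Complex.re_eq_add_conj, map_mul]
  ring
where
  intervalIntegral_conj {g : ℝ → ℂ} : ∫ x in (0 : ℝ)..2 * Real.pi, (starRingEnd ℂ) (g x) =
      (starRingEnd ℂ) (∫ x in (0 : ℝ)..2 * Real.pi, g x) := by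
    rw [intervalIntegral.integral_of_le Real.two_pi_pos.le,
      intervalIntegral.integral_of_le Real.two_pi_pos.le, integral_conj]

end Fourier

/-! ### Boundary values -/

section BoundaryValues

theorem circleMap_mem_closedDisk (θ : ℝ) : circleMap 0 1 θ ∈ closedBall (0 : ℂ) 1 :=
  circleMap_mem_closedBall 0 zero_le_one θ

theorem exists_circleMap_eq {z : ℂ} (hz : z ∈ sphere (0 : ℂ) 1) : ∃ θ : ℝ, circleMap 0 1 θ = z := by
  rw [← abs_one (α := ℝ), ← range_circleMap] at hz
  exact hz

theorem DiskFun.diffContOnCl (p : DiskFun 1) : DiffContOnCl ℂ p (ball 0 1) :=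
  ⟨p.differentiableOn_ball, by
    rw [closure_ball _ one_ne_zero]
    exact p.continuousOn⟩

theorem DiskFun.continuous_comp_circleMap (p : DiskFun 1) :
    Continuous fun θ => p (circleMap 0 1 θ) :=
  p.continuousOn.comp_continuous (continuous_circleMap 0 1) circleMap_mem_closedDisk

/-- The mean value property, up to the boundary. -/
theorem integral_circleMap_eq {g : ℂ → ℂ} (hc : ContinuousOn g (closedBall 0 1))
    (hd : DifferentiableOn ℂ g (ball 0 1)) :
    ∫ θ in (0 : ℝ)..2 * Real.pi, g (circleMap 0 1 θ) = 2 * Real.pi * g 0 := by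
  have h1 := Complex.circleIntegral_sub_center_inv_smul_of_differentiable_on_off_countable
    one_pos countable_empty hc
    fun z hz => (hd z hz.1).differentiableAt (isOpen_ball.mem_nhds hz.1)
  rw [circleIntegral] at h1
  have h2 : ∀ θ : ℝ, deriv (circleMap 0 1) θ • (circleMap 0 1 θ - 0)⁻¹ • g (circleMap 0 1 θ) =
      Complex.I * g (circleMap 0 1 θ) := by
    intro θ
    have h3 : circleMap 0 1 θ ≠ 0 := circleMap_ne_center one_ne_zero
    rw [deriv_circleMap, sub_zero, smul_eq_mul, smul_eq_mul]
    field_simp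
  simp_rw [h2] at h1
  rw [intervalIntegral.integral_const_mul, smul_eq_mul] at h1
  exact mul_left_cancel₀ Complex.I_ne_zero (by rw [h1]; ring)

/-- A function is determined by its boundary values. -/
theorem DiskFun.eq_of_boundary_eq {p q : DiskFun 1}
    (h : ∀ θ : ℝ, p (circleMap 0 1 θ) = q (circleMap 0 1 θ)) : p = q := by
  refine DiskFun.ext_of_eqOn ?_
  rw [← closure_ball (0 : ℂ) one_ne_zero]
  refine Complex.eqOn_closure_of_eqOn_frontier isBounded_ball p.diffContOnCl q.diffContOnCl ?_
  intro z hz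
  rw [frontier_ball _ one_ne_zero] at hz
  obtain ⟨θ, rfl⟩ := exists_circleMap_eq hz
  exact h θ

/-- A function vanishing at the origin whose real part vanishes on the circle is zero. -/
theorem DiskFun.eq_zero_of_re_boundary_eq_zero {p : DiskFun 1} (h0 : p 0 = 0)
    (h : ∀ θ : ℝ, (p (circleMap 0 1 θ)).re = 0) : p = 0 := by
  have hcont := p.continuous_comp_circleMap
  -- Mean value property of `p²`: on the circle `p² = -(Im p)²`, and the mean is `p(0)² = 0`, so `Im
  -- p` vanishes there too.
  have h1 := integral_circleMap_eq (p.continuousOn.mul p.continuousOn)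
    (p.differentiableOn_ball.mul p.differentiableOn_ball)
  have h2 : ∀ θ : ℝ, (p.1 * p.1) (circleMap 0 1 θ) =
      ((-(p (circleMap 0 1 θ)).im ^ 2 : ℝ) : ℂ) := by
    intro θ
    apply Complex.ext
    · simp only [Pi.mul_apply, Complex.mul_re, Complex.ofReal_re, h θ]
      ring
    · simp only [Pi.mul_apply, Complex.mul_im, Complex.ofReal_im, h θ]
      ring
  simp_rw [h2] at h1
  rw [intervalIntegral.integral_ofReal, Pi.mul_apply, h0, mul_zero, mul_zero,
    Complex.ofReal_eq_zero, intervalIntegral.integral_neg, neg_eq_zero] at h1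
  have hzero : ∀ θ ∈ Icc (0 : ℝ) (2 * Real.pi), (p (circleMap 0 1 θ)).im = 0 := by
    intro θ hθ
    by_contra hne
    have hc : Continuous fun θ => (p (circleMap 0 1 θ)).im ^ 2 :=
      (Complex.continuous_im.comp hcont).pow 2
    have := intervalIntegral.integral_pos Real.two_pi_pos hc.continuousOn
      (fun x _ => sq_nonneg _) ⟨θ, hθ, by positivity⟩
    exact this.ne' h1
  refine DiskFun.eq_of_boundary_eq fun θ => ?_
  obtain ⟨θ', hθ', he⟩ := (periodic_circleMap 0 1).exists_mem_Ico₀ Real.two_pi_pos θ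
  rw [he]
  exact Complex.ext (h θ') (hzero θ' ⟨hθ'.1, hθ'.2.le⟩)

end BoundaryValues

/-! ### The `(1,0)` space -/

section OneZero

theorem fourierComplex_zero (φ : Vect₀) : fourierComplex φ.1 0 = 0 := by
  simp [fourierComplex, fourierCos, fourierSin, φ.2.2.2]

/-- The holomorphic function whose boundary values are `(φ - i J φ) / 2`. -/
noncomputable def holomorphicPart (φ : Vect₀) : DiskFun 1 :=
  DiskFun.ofCoeffs (fun n => 1 / 2 * fourierComplex φ.1 n)
    ((rapidDecay_fourierComplex φ.2.1 φ.2.2.1).const_mul (1 / 2))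

theorem coeff_holomorphicPart (φ : Vect₀) (n : ℕ) :
    coeff (holomorphicPart φ) n = 1 / 2 * fourierComplex φ.1 n :=
  DiskFun.coeff_ofCoeffs _ n

theorem holomorphicPart_zero (φ : Vect₀) : holomorphicPart φ 0 = 0 := by
  rw [holomorphicPart, DiskFun.ofCoeffs_apply _ zero_mem_closedDisk, powerSum_zero,
    fourierComplex_zero, mul_zero]

theorem holomorphicPart_circleMap (φ : Vect₀) (θ : ℝ) : holomorphicPart φ (circleMap 0 1 θ) =
    1 / 2 * (φ.1 θ - Complex.I * (complexStructureJ φ).1 θ) := by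
  have hs := summable_powerSum (rapidDecay_fourierComplex φ.2.1 φ.2.2.1).summable_norm
    (mem_closedBall_zero_iff.1 (circleMap_mem_closedDisk θ))
  have hre : (powerSum (fourierComplex φ.1) (circleMap 0 1 θ)).re = φ.1 θ := by
    have h1 := hasSum_re_fourierComplex φ.2.1 φ.2.2.1 φ.2.2.2 θ
    exact (Complex.hasSum_re hs.hasSum).unique (by exact_mod_cast h1)
  have him : (powerSum (fourierComplex φ.1) (circleMap 0 1 θ)).im = -(complexStructureJ φ).1 θ := by
    change _ = -conjSeries φ.1 θ
    rw [powerSum, hs.tsum_eq_zero_add, fourierComplex_zero, zero_mul, zero_add, conjSeries,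
      Complex.im_tsum ((summable_nat_add_iff 1).2 hs)]
    simp_rw [conjTerm_eq_im, tsum_neg, neg_neg]
  rw [holomorphicPart, DiskFun.ofCoeffs_apply _ (circleMap_mem_closedDisk θ)]
  have h2 : powerSum (fun n => 1 / 2 * fourierComplex φ.1 n) (circleMap 0 1 θ) =
      1 / 2 * powerSum (fourierComplex φ.1) (circleMap 0 1 θ) := by
    simp_rw [powerSum, mul_assoc, tsum_mul_left]
  rw [h2, ← Complex.re_add_im (powerSum (fourierComplex φ.1) (circleMap 0 1 θ)), hre, him]
  push_cast
  ring

theorem holomorphicPart_circleMap_re (φ : Vect₀) (θ : ℝ) :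
    (holomorphicPart φ (circleMap 0 1 θ)).re = 1 / 2 * φ.1 θ := by
  rw [holomorphicPart_circleMap, show (1 / 2 : ℂ) = ((1 / 2 : ℝ) : ℂ) by push_cast; rfl,
    Complex.re_ofReal_mul]
  simp

theorem eq_holomorphicPart {p : DiskFun 1} (h0 : p 0 = 0) (φ : Vect₀)
    (h : ∀ θ : ℝ, (p (circleMap 0 1 θ)).re = 1 / 2 * φ.1 θ) : p = holomorphicPart φ := by
  rw [← sub_eq_zero]
  refine DiskFun.eq_zero_of_re_boundary_eq_zero ?_ fun θ => ?_
  · change p 0 - holomorphicPart φ 0 = 0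
    rw [h0, holomorphicPart_zero, sub_zero]
  · change (p (circleMap 0 1 θ) - holomorphicPart φ (circleMap 0 1 θ)).re = 0
    rw [Complex.sub_re, h, holomorphicPart_circleMap_re, sub_self]

/-- Multiplying `(φ - i Jφ) / 2` by `i` gives a holomorphic function with real part `Jφ / 2`, which
by uniqueness is the one belonging to `Jφ`. Comparing imaginary parts spares computing the Fourier
coefficients of `Jφ`. -/
theorem complexStructureJ_sq (φ : Vect₀) : complexStructureJ (complexStructureJ φ) = -φ := by
  have h1 : Complex.I • holomorphicPart φ = holomorphicPart (complexStructureJ φ) := by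
    refine eq_holomorphicPart ?_ _ fun θ => ?_
    · change Complex.I * holomorphicPart φ 0 = 0
      rw [holomorphicPart_zero, mul_zero]
    · change (Complex.I * holomorphicPart φ (circleMap 0 1 θ)).re = _
      rw [holomorphicPart_circleMap]
      simp
  apply Subtype.ext
  funext θ
  have h2 : Complex.I * holomorphicPart φ (circleMap 0 1 θ) =
      holomorphicPart (complexStructureJ φ) (circleMap 0 1 θ) := by rw [← h1]; rfl
  rw [holomorphicPart_circleMap, holomorphicPart_circleMap] at h2
  have h3 := congrArg Complex.im h2
  simp at h3
  change _ = -φ.1 θ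
  linarith

theorem toBoundaryFun_tmul (c : ℂ) (φ : Vect₀) (θ : ℝ) :
    toBoundaryFun (c ⊗ₜ[ℝ] φ) θ = c * φ.1 θ := by
  rw [toBoundaryFun, LinearMap.liftBaseChange_tmul]
  rfl

theorem complexStructureJC_tmul (c : ℂ) (φ : Vect₀) :
    complexStructureJC (c ⊗ₜ[ℝ] φ) = c ⊗ₜ[ℝ] complexStructureJ φ :=
  LinearMap.baseChange_tmul _ _ _

theorem exists_eq_one_tmul_add_I_tmul (v : Vect₀C) :
    ∃ φ ψ : Vect₀, v = (1 : ℂ) ⊗ₜ[ℝ] φ + Complex.I ⊗ₜ[ℝ] ψ := by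
  induction v using TensorProduct.induction_on with
  | zero => exact ⟨0, 0, by simp⟩
  | tmul c φ =>
    refine ⟨c.re • φ, c.im • φ, ?_⟩
    rw [← TensorProduct.smul_tmul, ← TensorProduct.smul_tmul, ← TensorProduct.add_tmul]
    congr 1
    simp only [Complex.real_smul, mul_one, Complex.re_add_im]
  | add v w hv hw =>
    obtain ⟨φ, ψ, rfl⟩ := hv
    obtain ⟨φ', ψ', rfl⟩ := hw
    refine ⟨φ + φ', ψ + ψ', ?_⟩
    rw [TensorProduct.tmul_add, TensorProduct.tmul_add]
    abel

/-- The isomorphism `φ ↦ (φ - i J φ) / 2` of `Vect₀ S¹` onto the `(1,0)` space. -/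
noncomputable def projection10 (φ : Vect₀) : Vect₀10 :=
  ⟨(1 / 2 : ℂ) • ((1 : ℂ) ⊗ₜ[ℝ] φ - Complex.I ⊗ₜ[ℝ] complexStructureJ φ), by
    rw [Vect₀10, Module.End.mem_eigenspace_iff, map_smul, map_sub, complexStructureJC_tmul,
      complexStructureJC_tmul, complexStructureJ_sq, smul_comm Complex.I]
    congr 1
    rw [smul_sub, TensorProduct.smul_tmul', TensorProduct.smul_tmul', smul_eq_mul, smul_eq_mul,
      mul_one, Complex.I_mul_I, TensorProduct.tmul_neg, TensorProduct.neg_tmul]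
    abel⟩

theorem toBoundaryFun_projection10 (φ : Vect₀) (θ : ℝ) :
    toBoundaryFun (projection10 φ) θ = holomorphicPart φ (circleMap 0 1 θ) := by
  rw [holomorphicPart_circleMap]
  change toBoundaryFun ((1 / 2 : ℂ) • ((1 : ℂ) ⊗ₜ[ℝ] φ - Complex.I ⊗ₜ[ℝ] complexStructureJ φ)) θ = _
  rw [map_smul, map_sub, Pi.smul_apply, Pi.sub_apply, toBoundaryFun_tmul, toBoundaryFun_tmul,
    one_mul, smul_eq_mul]

theorem projection10_surjective : Function.Surjective projection10 := by
  intro v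
  obtain ⟨φ, ψ, hv⟩ := exists_eq_one_tmul_add_I_tmul v.1
  have h1 := Module.End.mem_eigenspace_iff.1 v.2
  -- This is the real part of the eigenvalue equation for `φ + iψ`.
  have hψ : ψ = -complexStructureJ φ := by
    have h2 := congrArg (fun w => toBoundaryFun w) h1
    rw [hv] at h2
    apply Subtype.ext
    funext θ
    have h3 := congrArg Complex.re (congrFun h2 θ)
    simp only [map_add, map_smul, complexStructureJC_tmul, Pi.add_apply, Pi.smul_apply,
      toBoundaryFun_tmul] at h3
    simp at h3
    change ψ.1 θ = -(complexStructureJ φ).1 θ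
    linarith
  -- Here `v = φ - i Jφ`, and the projection carries a factor `1/2`.
  refine ⟨(2 : ℝ) • φ, Subtype.ext ?_⟩
  change (1 / 2 : ℂ) • ((1 : ℂ) ⊗ₜ[ℝ] ((2 : ℝ) • φ) -
    Complex.I ⊗ₜ[ℝ] complexStructureJ ((2 : ℝ) • φ)) = v.1
  rw [hv, hψ, map_smul, ← TensorProduct.smul_tmul, ← TensorProduct.smul_tmul, smul_sub,
    TensorProduct.smul_tmul', TensorProduct.smul_tmul', TensorProduct.tmul_neg, sub_eq_add_neg]
  congr 3 <;> simp

theorem toBoundaryFun_injOn : Function.Injective fun v : Vect₀10 => toBoundaryFun (v : Vect₀C) := by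
  intro v w hvw
  obtain ⟨φ, rfl⟩ := projection10_surjective v
  obtain ⟨ψ, rfl⟩ := projection10_surjective w
  congr 1
  apply Subtype.ext
  funext θ
  have h1 := congrArg Complex.re (congrFun hvw θ)
  simp only [toBoundaryFun_projection10, holomorphicPart_circleMap_re] at h1
  linarith

theorem projection10_injective : Function.Injective projection10 := by
  intro φ ψ h
  apply Subtype.ext
  funext θ
  have h1 := congrArg (fun v : Vect₀10 => (toBoundaryFun (v : Vect₀C) θ).re) h
  simp only [toBoundaryFun_projection10, holomorphicPart_circleMap_re] at h1
  linarith

theorem projection10_complexStructureJ (φ : Vect₀) :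
    projection10 (complexStructureJ φ) = Complex.I • projection10 φ := by
  apply Subtype.ext
  change (1 / 2 : ℂ) • ((1 : ℂ) ⊗ₜ[ℝ] complexStructureJ φ -
    Complex.I ⊗ₜ[ℝ] complexStructureJ (complexStructureJ φ)) = Complex.I • (projection10 φ).1
  rw [← Module.End.mem_eigenspace_iff.1 (projection10 φ).2]
  change _ = complexStructureJC ((1 / 2 : ℂ) • ((1 : ℂ) ⊗ₜ[ℝ] φ -
    Complex.I ⊗ₜ[ℝ] complexStructureJ φ))
  rw [map_smul, map_sub, complexStructureJC_tmul, complexStructureJC_tmul]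

/-- Twice the real part of the boundary values of a function vanishing at the origin. -/
noncomputable def boundaryRe (q : DiskFun 1) (hq : q 0 = 0) : Vect₀ :=
  ⟨fun θ => 2 * (q (circleMap 0 1 θ)).re, by
    have h1 : ContDiff ℝ ∞ fun θ => q (circleMap 0 1 θ) :=
      (q.contDiffOn.restrict_scalars ℝ).comp_contDiff (contDiff_circleMap 0 1)
        circleMap_mem_closedDisk
    exact contDiff_const.mul (Complex.reCLM.contDiff.comp h1), fun θ => by
    simp only [periodic_circleMap 0 1 θ], by
    have h1 := integral_circleMap_eq q.continuousOn q.differentiableOn_ball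
    rw [hq, mul_zero] at h1
    have h2 := intervalIntegral.intervalIntegral_re
      (𝕜 := ℂ) (μ := MeasureTheory.volume) (q.continuous_comp_circleMap.intervalIntegrable 0 (2 * Real.pi))
    rw [h1] at h2
    rw [intervalIntegral.integral_const_mul]
    simpa using h2⟩

theorem holomorphicPart_boundaryRe (q : DiskFun 1) (hq : q 0 = 0) :
    holomorphicPart (boundaryRe q hq) = q := by
  refine (eq_holomorphicPart hq _ fun θ => ?_).symm
  change _ = 1 / 2 * (2 * (q (circleMap 0 1 θ)).re)
  ring

end OneZero

/-! ### Taylor coefficients -/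

section TaylorCoefficients

/-- Taylor expansion in the open disk, then continuity on the boundary. The coefficient of order `0`
is zero and may be omitted. -/
theorem coeff_injective : Function.Injective fun (h : DiskFun₀ 1) (n : ℕ) => coeff h.1 (n + 1) := by
  intro g h hgh
  have key : ∀ z ∈ ball (0 : ℂ) 1, g z = h z := by
    intro z hz
    have h1 := Complex.hasSum_taylorSeries_on_ball g.1.differentiableOn_ball hz
    have h2 := Complex.hasSum_taylorSeries_on_ball h.1.differentiableOn_ball hz
    refine h1.unique ?_
    convert h2 using 2 with n
    congr 2
    rcases n with _ | n
    · rw [iteratedDeriv_zero, iteratedDeriv_zero]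
      exact (show g.1 0 = 0 from g.2).trans (show h.1 0 = 0 from h.2).symm
    · have h3 := congrFun hgh n
      simp only [coeff] at h3
      exact (div_left_inj' (by exact_mod_cast (n + 1).factorial_ne_zero)).1 h3
  exact DiskFun₀.ext_of_eqOn (EqOn.of_subset_closure key g.1.continuousOn h.1.continuousOn
    ball_subset_closedBall (closure_ball (0 : ℂ) one_ne_zero).ge)

theorem iteratedDeriv_mul_div_factorial {f g : ℂ → ℂ} {x : ℂ} (n : ℕ) (hf : ContDiffAt ℂ n f x)
    (hg : ContDiffAt ℂ n g x) :
    iteratedDeriv n (f * g) x / n.factorial = ∑ k ∈ Finset.range (n + 1),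
      iteratedDeriv k f x / k.factorial * (iteratedDeriv (n - k) g x / (n - k).factorial) := by
  rw [iteratedDeriv_mul hf hg, Finset.sum_div]
  refine Finset.sum_congr rfl fun k hk => ?_
  have hk' : k ≤ n := Nat.lt_succ_iff.1 (Finset.mem_range.1 hk)
  rw [Nat.cast_choose ℂ hk']
  have h1 : (n.factorial : ℂ) ≠ 0 := by exact_mod_cast n.factorial_ne_zero
  field_simp

theorem DiskFun.contDiffAt_zero (p : DiskFun 1) : ContDiffAt ℂ ∞ p 0 :=
  p.contDiffOn.contDiffAt (closedDisk_mem_nhds (mem_ball_self one_pos))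

theorem dz_eventuallyEq_deriv (f : DiskFun 1) : dz f =ᶠ[𝓝 0] deriv f := by
  filter_upwards [isOpen_ball.mem_nhds (mem_ball_self (x := (0 : ℂ)) one_pos)] with z hz
    using (f.hasDerivAt hz).deriv.symm

/-- The factor `z` shifts the index by one, and what remains is the Cauchy product of `f'` and `q`.
-/
theorem coeff_lk_succ (f q : DiskFun 1) (n : ℕ) :
    coeff (lk f q).1 (n + 1) =
      ∑ k ∈ Finset.range (n + 1), (k + 1 : ℂ) * coeff f (k + 1) * coeff q (n - k) := by
  have hdz : ContDiffAt ℂ ∞ (dz f) 0 :=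
    (dz_contDiffOn f).contDiffAt (closedDisk_mem_nhds (mem_ball_self one_pos))
  have hle : ∀ n : ℕ, (n : WithTop ℕ∞) ≤ ∞ := fun n => by exact_mod_cast le_top
  have h1 : ((lk f q).1 : ℂ → ℂ) = id * (dz f * q.1) := by
    funext z
    simp [mul_assoc]
  have h2 : ∀ k, iteratedDeriv k (dz f) 0 / k.factorial = (k + 1) * coeff f (k + 1) := by
    intro k
    have h3 : (k.factorial : ℂ) ≠ 0 := by exact_mod_cast k.factorial_ne_zero
    have h4 : (k + 1 : ℂ) ≠ 0 := by exact_mod_cast k.succ_ne_zero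
    rw [(dz_eventuallyEq_deriv f).iteratedDeriv_eq, ← iteratedDeriv_succ', coeff,
      Nat.factorial_succ]
    push_cast
    field_simp
  have h5 : ContDiffAt ℂ (n + 1 : ℕ) (dz f * q.1) 0 := (hdz.mul q.contDiffAt_zero).of_le (hle _)
  rw [coeff, h1, iteratedDeriv_mul_div_factorial (n + 1) contDiffAt_id h5, Finset.sum_eq_single 1]
  · rw [iteratedDeriv_one, deriv_id, Nat.factorial_one, Nat.cast_one, div_one, one_mul,
      Nat.add_sub_cancel, iteratedDeriv_mul_div_factorial n (hdz.of_le (hle _))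
        (q.contDiffAt_zero.of_le (hle _))]
    simp_rw [h2]
    rfl
  · intro k _ hk
    rcases k with _ | _ | k
    · simp
    · exact absurd rfl hk
    · rw [iteratedDeriv_succ', iteratedDeriv_succ', deriv_id', deriv_const', iteratedDeriv_const]
      simp
  · simp

theorem coeff_one_of_pos {n : ℕ} (hn : 1 ≤ n) : coeff (DiskFun.one 1) n = 0 := by
  have h1 : (DiskFun.one 1).1 =ᶠ[𝓝 0] fun _ => (1 : ℂ) := by
    filter_upwards [closedDisk_mem_nhds (mem_ball_self (one_pos (α := ℝ)))] with z hz
      using DiskFun.one_apply hz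
  rw [coeff, h1.iteratedDeriv_eq, iteratedDeriv_const, if_neg (by omega), zero_div]

theorem coeff_sub_smul_one (p : DiskFun 1) (c : ℂ) {n : ℕ} (hn : 1 ≤ n) :
    coeff (p - c • DiskFun.one 1) n = coeff p n := by
  have h1 := map_sub (coeffLinear 1 n) p (c • DiskFun.one 1)
  rw [map_smul] at h1
  have h2 : coeffLinear 1 n (DiskFun.one 1) = 0 := coeff_one_of_pos hn
  rw [h2, smul_zero, sub_zero] at h1
  exact h1

theorem coeff_smul (c : ℂ) (p : DiskFun 1) (n : ℕ) : coeff (c • p) n = c * coeff p n :=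
  map_smul (coeffLinear 1 n) c p

theorem coeff_zero (p : DiskFun 1) : coeff p 0 = p 0 := by
  simp [coeff]

end TaylorCoefficients

/-! ### The Schaeffer–Spencer variation -/

section Variation

variable {f : DiskFun₀ 1}

/-- The integrand of the variation, freed of its singularities and multiplied by `w - z`. -/
noncomputable def variationKernel (f : DiskFun₀ 1) (q : DiskFun 1) (z w : ℂ) : ℂ :=
  dz f.1 w ^ 2 * dslope q 0 w / (dslope f 0 w ^ 2 * dslope f z w)

/-- Injectivity gives this off the diagonal, `f' ≠ 0` on it. Hence the denominator of the kernel has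
no zeros. -/
theorem dslope_ne_zero (hf : f ∈ UnivS₀ 1) {z w : ℂ} (hz : z ∈ ball (0 : ℂ) 1)
    (hw : w ∈ closedBall (0 : ℂ) 1) : dslope f z w ≠ 0 := by
  by_cases h : w = z
  · rw [h, dslope_same, (f.1.hasDerivAt hz).deriv]
    exact hf.2 z (ball_subset_closedBall hz)
  · rw [dslope_of_ne _ h, slope_def_field]
    exact div_ne_zero (sub_ne_zero.2 fun e => h (hf.1 hw (ball_subset_closedBall hz) e))
      (sub_ne_zero.2 h)

theorem DiskFun.continuousOn_dslope (p : DiskFun 1) {z : ℂ} (hz : z ∈ ball (0 : ℂ) 1) :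
    ContinuousOn (dslope p z) (closedBall 0 1) :=
  (_root_.continuousOn_dslope (closedDisk_mem_nhds hz)).2
    ⟨p.continuousOn, (p.hasDerivAt hz).differentiableAt⟩

theorem DiskFun.differentiableOn_dslope (p : DiskFun 1) {z : ℂ} (hz : z ∈ ball (0 : ℂ) 1) :
    DifferentiableOn ℂ (dslope p z) (ball 0 1) :=
  (Complex.differentiableOn_dslope (isOpen_ball.mem_nhds hz)).2 p.differentiableOn_ball

theorem variationKernel_continuousOn (hf : f ∈ UnivS₀ 1) (q : DiskFun 1) {z : ℂ}
    (hz : z ∈ ball (0 : ℂ) 1) : ContinuousOn (variationKernel f q z) (closedBall 0 1) := by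
  have h0 : (0 : ℂ) ∈ ball (0 : ℂ) 1 := mem_ball_self one_pos
  exact (((dz_contDiffOn f.1).continuousOn.pow 2).mul (q.continuousOn_dslope h0)).div
    (((f.1.continuousOn_dslope h0).pow 2).mul (f.1.continuousOn_dslope hz))
    fun w hw => mul_ne_zero (pow_ne_zero 2 (dslope_ne_zero hf h0 hw)) (dslope_ne_zero hf hz hw)

theorem variationKernel_differentiableOn (hf : f ∈ UnivS₀ 1) (q : DiskFun 1) {z : ℂ}
    (hz : z ∈ ball (0 : ℂ) 1) : DifferentiableOn ℂ (variationKernel f q z) (ball 0 1) := by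
  have h0 : (0 : ℂ) ∈ ball (0 : ℂ) 1 := mem_ball_self one_pos
  have hsub : ball (0 : ℂ) 1 ⊆ closedBall 0 1 := ball_subset_closedBall
  exact (((((dz_contDiffOn f.1).differentiableOn (by simp)).mono hsub).pow 2).mul
    (q.differentiableOn_dslope h0)).div
    (((f.1.differentiableOn_dslope h0).pow 2).mul (f.1.differentiableOn_dslope hz))
    fun w hw => mul_ne_zero (pow_ne_zero 2 (dslope_ne_zero hf h0 (hsub hw)))
      (dslope_ne_zero hf hz (hsub hw))

theorem DiskFun.eq_mul_dslope {q : DiskFun 1} (hq : q 0 = 0) (w : ℂ) : q w = w * dslope q 0 w := by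
  have h1 := sub_smul_dslope q.1 0 w
  rw [hq, sub_zero, sub_zero, smul_eq_mul] at h1
  exact h1.symm

/-- The variation by the vector field `-i q` is `z f' q`. -/
theorem variation_eq_lk (hf : f ∈ UnivS₀ 1) {q : DiskFun 1} (hq : q 0 = 0) {z : ℂ}
    (hz : z ∈ ball (0 : ℂ) 1) :
    variation f (fun θ => -Complex.I * q (circleMap 0 1 θ)) z = lk f.1 q z := by
  have h0 : (0 : ℂ) ∈ ball (0 : ℂ) 1 := mem_ball_self one_pos
  have hf0 : f.1 0 = 0 := f.2
  have hcauchy :=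
    Complex.two_pi_I_inv_smul_circleIntegral_sub_inv_smul_of_differentiable_on_off_countable
      countable_empty hz (variationKernel_continuousOn hf q hz) fun x hx =>
        (variationKernel_differentiableOn hf q hz x hx.1).differentiableAt
          (isOpen_ball.mem_nhds hx.1)
  -- Extract `w` from `f(w)` and `q(w)`, and `w - z` from `f(w) - f(z)`. The zero of `q` at `0`
  -- cancels the explicit `1 / w`, and a Cauchy integrand is left.
  have hint : ∀ θ : ℝ,
      (circleMap 0 1 θ * dz f.1 (circleMap 0 1 θ) / f (circleMap 0 1 θ)) ^ 2 *
        (-Complex.I * q (circleMap 0 1 θ)) /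
          (circleMap 0 1 θ * (f (circleMap 0 1 θ) - f z)) * deriv (circleMap 0 1) θ =
      -Complex.I * (deriv (circleMap 0 1) θ •
        ((circleMap 0 1 θ - z)⁻¹ • variationKernel f q z (circleMap 0 1 θ))) := by
    intro θ
    have hw := circleMap_mem_closedDisk θ
    set w := circleMap 0 1 θ with hwdef
    have hw0 : w ≠ 0 := circleMap_ne_center one_ne_zero
    have hwz : w - z ≠ 0 := by
      rw [sub_ne_zero]
      rintro rfl
      have h1 : ‖w‖ = 1 := by simp [hwdef]
      rw [mem_ball_zero_iff, h1] at hz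
      exact lt_irrefl _ hz
    have h1 := dslope_ne_zero hf h0 hw
    have h2 := dslope_ne_zero hf hz hw
    have h3 : f w - f z = (w - z) * dslope f z w := (sub_smul_dslope f.1.1 z w).symm
    rw [h3, DiskFun.eq_mul_dslope hq w, DiskFun.eq_mul_dslope hf0 w, variationKernel, smul_eq_mul,
      smul_eq_mul]
    field_simp
  rw [variation]
  simp_rw [hint]
  rw [intervalIntegral.integral_const_mul]
  change f z ^ 2 / (2 * Real.pi) * (-Complex.I * ∮ w in C(0, 1), (w - z)⁻¹ •
    variationKernel f q z w) = _
  have hpi : (Real.pi : ℂ) ≠ 0 := Complex.ofReal_ne_zero.2 Real.pi_ne_zero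
  rw [smul_eq_mul, inv_mul_eq_iff_eq_mul₀ Complex.two_pi_I_ne_zero] at hcauchy
  rw [hcauchy, variationKernel, dslope_same, (f.1.hasDerivAt hz).deriv, lk_apply,
    DiskFun.eq_mul_dslope hq z, DiskFun.eq_mul_dslope hf0 z]
  have h1 := dslope_ne_zero hf h0 (ball_subset_closedBall hz)
  have h2 := hf.2 z (ball_subset_closedBall hz)
  field_simp
  linear_combination (-(z ^ 2 * dslope q.1 0 z)) * Complex.I_sq

end Variation

/-! ### The action of the `(1,0)` space -/

section Action

/-- Since `v = -i q` means `q = i v`, existence follows by writing `v` as a projection of some `φ`.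
Uniqueness is what makes the extension linear in `v`. -/
theorem existsUnique_holomorphicExtension (v : Vect₀10) :
    ∃! q : DiskFun 1, q 0 = 0 ∧
      ∀ θ : ℝ, q (circleMap 0 1 θ) = Complex.I * toBoundaryFun (v : Vect₀C) θ := by
  obtain ⟨φ, rfl⟩ := projection10_surjective v
  refine ⟨Complex.I • holomorphicPart φ, ⟨?_, fun θ => ?_⟩, fun q hq => ?_⟩
  · change Complex.I * holomorphicPart φ 0 = 0
    rw [holomorphicPart_zero, mul_zero]
  · rw [toBoundaryFun_projection10]
    rfl
  · refine DiskFun.eq_of_boundary_eq fun θ => ?_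
    rw [hq.2, toBoundaryFun_projection10]
    rfl

/-- The holomorphic extension of `i v` to the disk. -/
noncomputable def holomorphicExtension : Vect₀10 →ₗ[ℂ] DiskFun 1 where
  toFun v := (existsUnique_holomorphicExtension v).choose
  map_add' v w := by
    refine ((existsUnique_holomorphicExtension (v + w)).choose_spec.2 _ ⟨?_, fun θ => ?_⟩).symm
    · exact (congrArg₂ (· + ·) (existsUnique_holomorphicExtension v).choose_spec.1.1
        (existsUnique_holomorphicExtension w).choose_spec.1.1).trans (add_zero 0)
    · refine (congrArg₂ (· + ·) ((existsUnique_holomorphicExtension v).choose_spec.1.2 θ)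
        ((existsUnique_holomorphicExtension w).choose_spec.1.2 θ)).trans ?_
      rw [Submodule.coe_add, map_add, Pi.add_apply, mul_add]
  map_smul' c v := by
    refine ((existsUnique_holomorphicExtension (c • v)).choose_spec.2 _ ⟨?_, fun θ => ?_⟩).symm
    · exact (congrArg (c * ·) (existsUnique_holomorphicExtension v).choose_spec.1.1).trans
        (mul_zero c)
    · refine (congrArg (c * ·) ((existsUnique_holomorphicExtension v).choose_spec.1.2 θ)).trans ?_
      rw [Submodule.coe_smul, map_smul, Pi.smul_apply, smul_eq_mul, mul_left_comm]

theorem holomorphicExtension_zero (v : Vect₀10) : holomorphicExtension v 0 = 0 :=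
  (existsUnique_holomorphicExtension v).choose_spec.1.1

theorem holomorphicExtension_circleMap (v : Vect₀10) (θ : ℝ) :
    holomorphicExtension v (circleMap 0 1 θ) = Complex.I * toBoundaryFun (v : Vect₀C) θ :=
  (existsUnique_holomorphicExtension v).choose_spec.1.2 θ

theorem holomorphicExtension_eq {v : Vect₀10} {q : DiskFun 1}
    (h : ∀ θ : ℝ, q (circleMap 0 1 θ) = Complex.I * toBoundaryFun (v : Vect₀C) θ) :
    holomorphicExtension v = q :=
  DiskFun.eq_of_boundary_eq fun θ => by rw [h, holomorphicExtension_circleMap]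

theorem toBoundaryFun_eq (v : Vect₀10) (θ : ℝ) :
    toBoundaryFun (v : Vect₀C) θ = -Complex.I * holomorphicExtension v (circleMap 0 1 θ) := by
  rw [holomorphicExtension_circleMap, ← mul_assoc, neg_mul, Complex.I_mul_I, neg_neg, one_mul]

theorem holomorphicExtension_injective : Function.Injective holomorphicExtension := by
  intro v w h
  refine toBoundaryFun_injOn (funext fun θ => ?_)
  simp only [toBoundaryFun_eq, h]

theorem holomorphicExtension_projection10 (φ : Vect₀) :
    holomorphicExtension (projection10 φ) = Complex.I • holomorphicPart φ :=
  holomorphicExtension_eq fun θ => by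
    rw [toBoundaryFun_projection10]
    rfl

theorem exists_holomorphicExtension_eq {q : DiskFun 1} (hq : q 0 = 0) :
    ∃ v, holomorphicExtension v = q := by
  have h0 : (-Complex.I • q : DiskFun 1) 0 = 0 := by
    change -Complex.I * q 0 = 0
    rw [hq, mul_zero]
  refine ⟨projection10 (boundaryRe (-Complex.I • q) h0), ?_⟩
  rw [holomorphicExtension_projection10, holomorphicPart_boundaryRe, smul_smul, mul_neg,
    Complex.I_mul_I, neg_neg, one_smul]

theorem sub_smul_one_zero (p : DiskFun 1) : (p - p 0 • DiskFun.one 1 : DiskFun 1) 0 = 0 := by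
  rw [sub_smul_one_apply p _ zero_mem_closedDisk, sub_self]

theorem boundary_relation_iff (p : DiskFun 1) (v : Vect₀10) :
    (∀ θ : ℝ, toBoundaryFun (v : Vect₀C) θ = -Complex.I * (p (circleMap 0 1 θ) - p 0)) ↔
      holomorphicExtension v = p - p 0 • DiskFun.one 1 := by
  constructor
  · intro h
    refine holomorphicExtension_eq fun θ => ?_
    rw [h, sub_smul_one_apply p _ (circleMap_mem_closedDisk θ), ← mul_assoc, mul_neg,
      Complex.I_mul_I, neg_neg, one_mul]
  · intro h θ
    rw [toBoundaryFun_eq, h, sub_smul_one_apply p _ (circleMap_mem_closedDisk θ)]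

/-- The left side is a function on the disk of radius `‖leadCoeff f‖`, which equals `1` only through
the normalization, so the comparison is pointwise on `ℂ`. -/
theorem rhsF2_apply_of_mem_UnivS {f : DiskFun₀ 1} (hf : f ∈ UnivS 1) (p : DiskFun 1) (z : ℂ) :
    rhsF2 f p z = lk f.1 (p - p 0 • DiskFun.one 1) z := by
  by_cases hz : z ∈ closedBall (0 : ℂ) 1
  · have h1 : leadCoeff f * z = z := by rw [hf.2, one_mul]
    rw [← embed₂_rhsF2 hf.1, embed₂_apply f _ hz]
    exact congrArg (rhsF2 f p).1.1 h1.symm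
  · rw [(lk f.1 _).1.eq_zero hz, (rhsF2 f p).1.eq_zero]
    rwa [hf.2, norm_one]

end Action

/-! ### The theorem -/

theorem theorem3 :
    -- `S₀` is open in the space of all `a₀ z + a₁ z² + ⋯`, and that space is its tangent space
    IsOpen (UnivS₀ 1) ∧
    (∀ F ∈ UnivS₀ 1, tangentSpaceOf (UnivS₀ 1) F = univ) ∧
    -- the alternate Löwner–Kufarev equation and its forms (F1), (F2) along a path in `S₀`
    (∀ (ε : ℝ) (F F' : ℝ → DiskFun₀ 1), IsC1Path (UnivS₀ 1) ε F F' → ∀ t ∈ Ioo (-ε) ε,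
      ∃ p : DiskFun 1, F' t = lk (F t).1 p ∧ (∀ q : DiskFun 1, F' t = lk (F t).1 q → q = p) ∧
        HasDerivAt (fun s => leadCoeff (F s)) (p 0 * leadCoeff (F t)) t ∧
        HasVelocityAt (fun s => factor₁ (F s)) (rhsF1 (F t) p) t ∧
        ∀ z : ℂ, ‖z‖ < ‖leadCoeff (F t)‖ →
          HasDerivAt (fun s => factor₂ (F s) z) (rhsF2 (F t) p z) t) ∧
    -- the first distribution is `TS`, and it is a sub-bundle of codimension one
    (∀ F ∈ UnivS₀ 1, factor₁ F ∈ UnivS 1 ∧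
      (dist₁ F : Set (DiskFun₀ 1)) = tangentSpaceOf (UnivS 1) (factor₁ F)) ∧
    IsCodimOneSubbundle (UnivS₀ 1) dist₁ ∧
    -- the second distribution
    (∀ F ∈ UnivS₀ 1, factor₂ F ∈ UnivS ‖leadCoeff F‖ ∧
      (LinearMap.range (rhsF2 F) : Set (DiskFun₀ ‖leadCoeff F‖)) =
        tangentSpaceOf (UnivS ‖leadCoeff F‖) (factor₂ F) ∧
      Function.Injective (embed₂ F) ∧
      (∀ p : DiskFun 1, embed₂ F (rhsF2 F p) = lk F.1 (p - p 0 • DiskFun.one 1))) ∧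
    IsCodimOneSubbundle (UnivS₀ 1) dist₂ ∧
    -- comparison of the two distributions
    (∀ F ∈ UnivS₀ 1, dist₁ F = dist₂ F ∧
      (LinearMap.ker (rhsF1 F)).map (lk F.1) = Submodule.span ℂ {F} ∧
      (LinearMap.ker (rhsF2 F)).map (lk F.1) = Submodule.span ℂ {lk F.1 (DiskFun.one 1)} ∧
      (LinearMap.ker (rhsF1 F) = LinearMap.ker (rhsF2 F) ↔
        ∀ z ∈ closedBall (0 : ℂ) 1, F z = leadCoeff F * z)) ∧
    -- the natural complex coordinates of `S` as embedded into `ℂ^ℕ` by its coefficients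
    Function.Injective (fun (h : DiskFun₀ 1) (n : ℕ) => coeff h.1 (n + 1)) ∧
    (∀ (ε : ℝ) (f f' : ℝ → DiskFun₀ 1), IsC1Path (UnivS 1) ε f f' → ∀ t ∈ Ioo (-ε) ε, ∀ n : ℕ,
      HasDerivAt (fun s => coeff (f s).1 n) (coeff (f' t).1 n) t) ∧
    -- the correspondence with the `(1,0)` space of `J`
    (∃ pr : Vect₀ → Vect₀10, Function.Bijective pr ∧
      (∀ φ : Vect₀, (pr φ : Vect₀C) =
        (1 / 2 : ℂ) • ((1 : ℂ) ⊗ₜ[ℝ] φ - Complex.I ⊗ₜ[ℝ] complexStructureJ φ)) ∧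
      ∀ f ∈ UnivS 1, ∃ Δ : Vect₀10 →ₗ[ℂ] DiskFun₀ 1,
        -- `Δ` is the Kirillov action, an isomorphism of the `(1,0)` space onto `T_f S`
        (∀ (v : Vect₀10) (z : ℂ), ‖z‖ < 1 → Δ v z = variation f (toBoundaryFun v) z) ∧
        Function.Injective Δ ∧
        (LinearMap.range Δ : Set (DiskFun₀ 1)) = tangentSpaceOf (UnivS 1) f ∧
        -- it carries `J` to the multiplication of all coefficients by `i`
        (∀ v v' : Vect₀10, (v' : Vect₀C) = complexStructureJC v →
          ∀ n : ℕ, coeff (Δ v').1 n = Complex.I * coeff (Δ v).1 n) ∧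
        (∀ (φ : Vect₀) (n : ℕ),
          coeff (Δ (pr (complexStructureJ φ))).1 n = Complex.I * coeff (Δ (pr φ)).1 n) ∧
        -- it is given by the right-hand side of (F2)
        (∀ p : DiskFun 1, ∃! v : Vect₀10,
          ∀ θ : ℝ, toBoundaryFun v θ = -Complex.I * (p (circleMap 0 1 θ) - p 0)) ∧
        (∀ v : Vect₀10, ∃ p : DiskFun 1,
          ∀ θ : ℝ, toBoundaryFun v θ = -Complex.I * (p (circleMap 0 1 θ) - p 0)) ∧
        (∀ (p : DiskFun 1) (v : Vect₀10),
          (∀ θ : ℝ, toBoundaryFun v θ = -Complex.I * (p (circleMap 0 1 θ) - p 0)) →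
          (∀ z : ℂ, Δ v z = rhsF2 f p z) ∧
          -- explicitly, in the coefficients
          (∀ n : ℕ, coeff (Δ v).1 (n + 1) =
            ∑ k ∈ Finset.range n, (k + 1 : ℂ) * coeff f.1 (k + 1) * coeff p (n - k)) ∧
          ∀ φ : Vect₀, v = pr φ → ∀ k : ℕ, 1 ≤ k →
            coeff p k = Complex.I / 2 * (fourierCos φ.1 k - Complex.I * fourierSin φ.1 k))) := by
  refine ⟨isOpen_UnivS₀, fun F hF => tangentSpaceOf_UnivS₀ hF, ?_, ?_, ?_, ?_, ?_, ?_,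
    coeff_injective, ?_, projection10, ⟨projection10_injective, projection10_surjective⟩,
    fun _ => rfl, ?_⟩
  · intro ε F F' hF t ht
    obtain ⟨hmem, hvel⟩ := hF.1 t ht
    obtain ⟨p, hp⟩ := lk_surjective hmem.2 (F' t)
    rw [← hp] at hvel
    exact ⟨p, hp.symm, fun q hq => lk_injective hmem.2 (hq.symm.trans hp.symm),
      hasDerivAt_leadCoeff hvel, hasVelocityAt_factor₁ hmem hvel,
      fun z hz => hasDerivAt_factor₂ hmem hvel hz⟩
  · intro F hF
    refine ⟨factor₁_mem hF, ?_⟩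
    rw [tangentSpaceOf_UnivS (factor₁_mem hF), dist₁, range_rhsF1 hF]
    ext h
    exact mem_ker_leadCoeffLinear
  · exact isCodimOneSubbundle_of_eq_ker_leadCoeff fun F hF => range_rhsF1 hF
  · intro F hF
    have := fact_norm_leadCoeff_pos hF
    exact ⟨factor₂_mem hF, by rw [range_rhsF2 hF, tangentSpaceOf_UnivS (factor₂_mem hF)],
      embed₂_injective hF, embed₂_rhsF2 hF⟩
  · exact isCodimOneSubbundle_of_eq_ker_leadCoeff fun F hF => dist₂_eq hF
  · exact fun F hF => ⟨(range_rhsF1 hF).trans (dist₂_eq hF).symm, map_ker_rhsF1 hF,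
      map_ker_rhsF2 hF, ker_rhsF1_eq_ker_rhsF2_iff hF⟩
  · intro ε f f' hf t ht n
    exact hasVelocityAt_iff_hasDerivAt.1 ((hf.1 t ht).2.map (coeffLinear 1 n ∘ₗ (DiskFun₀ 1).subtype)
      ((continuous_coeffLinear 1 n).comp continuous_subtype_val))
  intro f hf
  have hsmul : ∀ (v : Vect₀10) (n : ℕ),
      coeff (lk f.1 (holomorphicExtension (Complex.I • v))).1 n =
        Complex.I * coeff (lk f.1 (holomorphicExtension v)).1 n := by
    intro v n
    rw [map_smul, map_smul]
    exact coeff_smul _ _ _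
  -- The map `Δ` extends `i v` to a holomorphic `q` and sends it to `z f' q`.
  refine ⟨lk f.1 ∘ₗ holomorphicExtension, ?_,
    (lk_injective hf.1.2).comp holomorphicExtension_injective, ?_, ?_, ?_, ?_, ?_, ?_⟩
  · intro v z hz
    rw [show toBoundaryFun (v : Vect₀C) = fun θ => -Complex.I *
      holomorphicExtension v (circleMap 0 1 θ) from funext (toBoundaryFun_eq v),
      variation_eq_lk hf.1 (holomorphicExtension_zero v) (mem_ball_zero_iff.2 hz)]
    rfl
  · rw [tangentSpaceOf_UnivS hf]
    ext h
    constructor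
    · rintro ⟨v, rfl⟩
      change leadCoeff (lk f.1 (holomorphicExtension v)) = 0
      rw [leadCoeff_lk, holomorphicExtension_zero, mul_zero]
    · intro hh
      obtain ⟨q, rfl, hq0⟩ := exists_lk_eq_of_leadCoeff_eq_zero hf.1 hh
      obtain ⟨v, rfl⟩ := exists_holomorphicExtension_eq hq0
      exact ⟨v, rfl⟩
  · intro v v' hv n
    have h1 : v' = Complex.I • v := Subtype.ext (hv.trans (Module.End.mem_eigenspace_iff.1 v.2))
    rw [h1]
    exact hsmul v n
  · intro φ n
    rw [projection10_complexStructureJ]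
    exact hsmul _ n
  · intro p
    obtain ⟨v, hv⟩ := exists_holomorphicExtension_eq (sub_smul_one_zero p)
    exact ⟨v, (boundary_relation_iff p v).2 hv, fun w hw =>
      holomorphicExtension_injective (((boundary_relation_iff p w).1 hw).trans hv.symm)⟩
  · intro v
    refine ⟨holomorphicExtension v, fun θ => ?_⟩
    rw [toBoundaryFun_eq, holomorphicExtension_zero, sub_zero]
  · intro p v hv
    have hq := (boundary_relation_iff p v).1 hv
    refine ⟨fun z => ?_, fun n => ?_, ?_⟩
    · rw [rhsF2_apply_of_mem_UnivS hf, LinearMap.comp_apply, hq]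
    -- The last term of the Cauchy product contains `q(0) = 0` and drops out. In the rest `p - p(0)`
    -- and `p` have the same coefficients, since only positive orders occur.
    · rw [LinearMap.comp_apply, hq, coeff_lk_succ, Finset.sum_range_succ, Nat.sub_self, coeff_zero,
        sub_smul_one_zero, mul_zero, add_zero]
      refine Finset.sum_congr rfl fun k hk => ?_
      rw [coeff_sub_smul_one p _ (Nat.sub_pos_of_lt (Finset.mem_range.1 hk))]
    · rintro φ rfl k hk
      rw [← coeff_sub_smul_one p (p 0) hk, ← hq, holomorphicExtension_projection10, coeff_smul,
        coeff_holomorphicPart, fourierComplex]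
      ring
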